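/- Let $Q$ be a finite quiver with vertex set $I$, let $\mathsf f,d\in\mathbb N^I$, and let $Q^{\mathsf f}$ be the framed quiver obtained from $Q$ by adding a vertex $\infty$ and $\mathsf f_i$ arrows $\infty\to i$ for every $i\in I$. Let $\mathcal N_d$ be the noncommutative Hilbert scheme, i.e. the complex algebraic variety $R^{\mathsf f,s}/G_d$, where $R^{\mathsf f,s}\subset\bigoplus_{a:i\to j}\operatorname{Hom}(\mathbb C^{d_i},\mathbb C^{d_j})\oplus\bigoplus_i\operatorname{Hom}(\mathbb C^{\mathsf f_i},\mathbb C^{d_i})$ is the open set of those framed representations $M$ (representations of $Q^{\mathsf f}$ with $M_\infty=\mathbb C$) that are generated by $M_\infty$, and $G_d=\prod_i GL_{d_i}(\mathbb C)$. Let $\mathcal P$ be the set of paths in $Q^{\mathsf f}$ starting at $\infty$, partially ordered by $u\preceq v$ iff $v=wu$ for some path $w$. Let $\mathcal P(d)$ be the set of finite nonempty $\preceq$-lower sets $S\subset\mathcal P$ (trees) having exactly $d_i$ elements with target $i$, for each $i\in I$. The critical set $C(S)$ is the set of $\preceq$-minimal elements of $\mathcal P\setminus S$. For $M\in\mathcal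 N_d$ and $u\in\mathcal P$ put $m_u=u\cdot 1\in M$, where $1\in M_\infty=\mathbb C$. Fix an admissible order on $\mathcal P$, i.e. a total order $\le$ extending $\preceq$. For $S\in\mathcal P(d)$ let $U_S\subset\mathcal N_d$ be the set of $M$ such that $(m_u)_{u\in S}$ is a basis of $M$, and let $Z_S\subset U_S$ be the set of $M\in U_S$ such that $m_v\in\langle m_u : u\in S,\ u<v\rangle$ for all $v\in C(S)$. Order $\mathcal P(d)$ as follows: for $S=(v_1<\dots<v_k)$ and $S'=(v_1'<\dots<v_k')$, $S'<S$ if $v_i'<v_i$ for the minimal $i$ with $v_i'\neq v_i$. For $S\in\mathcal P(d)$ put $V_S=\bigcup_{S'\in\mathcal P(d),\,S'\le S}U_{S'}$. Then: 1. For every $S\in\mathcal P(d)$ the set $V_S$ is open in $\mathcal N_d$ and is the disjoint union $V_S=\bigsqcup_{S'\in\mathcal P(d),\,S'\le S}Z_{S'}$. 2. $\mathcal N_d=\bigsqcup_{S\in\mathcal P(d)}Z_S$. 3. $\mathcal P(d)$ is finite and totally ordered, say $S_1<\dots<S_r$, and with $V_0=\varnothing$ and $V_k=V_{S_k}$ for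 $1\le k\le r$ we get a filtration $\varnothing=V_0\subset V_1\subset\dots\subset V_r=\mathcal N_d$ by open subvarieties such that, for every $1\le k\le r$, the locally closed subvariety $V_k\setminus V_{k-1}$ is isomorphic to an affine space $\mathbb A^n$ for some $n\ge 0$. -/

import Mathlib

open Topology

universe u v

/-! ## Classical complex varieties as spaces with functions -/

/-- A (complex) space with functions: a topological space with a sheaf of algebras of `ℂ`-valued
functions such that the nonvanishing locus of a regular function is open and its inverse is regular
there.  A section over the open set `U` is a function `f : X → ℂ` of which only the values on `U`
are relevant. -/
structure SpaceWithFunctions (X : Type*) where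
  top : TopologicalSpace X
  IsRegular : Set X → (X → ℂ) → Prop
  congr : ∀ {U : Set X} {f g : X → ℂ}, IsOpen[top] U → Set.EqOn f g U →
    IsRegular U f → IsRegular U g
  mono : ∀ {U V : Set X} {f : X → ℂ}, IsOpen[top] U → IsOpen[top] V → V ⊆ U →
    IsRegular U f → IsRegular V f
  glue : ∀ {U : Set X} {f : X → ℂ}, IsOpen[top] U →
    (∀ x ∈ U, ∃ V, IsOpen[top] V ∧ x ∈ V ∧ V ⊆ U ∧ IsRegular V f) → IsRegular U f
  const : ∀ {U : Set X} (c : ℂ), IsOpen[top] U → IsRegular U (fun _ => c)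
  add : ∀ {U : Set X} {f g : X → ℂ}, IsOpen[top] U → IsRegular U f → IsRegular U g →
    IsRegular U (fun x => f x + g x)
  mul : ∀ {U : Set X} {f g : X → ℂ}, IsOpen[top] U → IsRegular U f → IsRegular U g →
    IsRegular U (fun x => f x * g x)
  isOpen_ne_zero : ∀ {U : Set X} {f : X → ℂ}, IsOpen[top] U → IsRegular U f →
    IsOpen[top] {x | x ∈ U ∧ f x ≠ 0}
  inv : ∀ {U : Set X} {f : X → ℂ}, IsOpen[top] U → IsRegular U f →
    IsRegular {x | x ∈ U ∧ f x ≠ 0} (fun x => (f x)⁻¹)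

namespace SpaceWithFunctions

/-- The Zariski topology on the affine space `σ → ℂ`: the principal open sets form a basis. -/
@[reducible]
def zariskiTopology (σ : Type*) : TopologicalSpace (σ → ℂ) where
  IsOpen U := ∀ x ∈ U, ∃ q : MvPolynomial σ ℂ, MvPolynomial.eval x q ≠ 0 ∧
    ∀ y, MvPolynomial.eval y q ≠ 0 → y ∈ U
  isOpen_univ := fun _ _ => ⟨1, by simp, fun _ _ => trivial⟩
  isOpen_inter := by
    rintro U V hU hV x ⟨hxU, hxV⟩
    obtain ⟨p, hp, hp'⟩ := hU x hxU
    obtain ⟨q, hq, hq'⟩ := hV x hxV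
    refine ⟨p * q, by simp [hp, hq], fun y hy => ?_⟩
    rw [map_mul] at hy
    exact ⟨hp' y (left_ne_zero_of_mul hy), hq' y (right_ne_zero_of_mul hy)⟩
  isOpen_sUnion := by
    rintro s hs x ⟨U, hU, hx⟩
    obtain ⟨q, hq, hq'⟩ := hs U hU x hx
    exact ⟨q, hq, fun y hy => ⟨U, hU, hq' y hy⟩⟩

/-- The affine space `𝔸^σ` over `ℂ`, with the Zariski topology; a function is regular on an open
set if it is locally a quotient of two polynomials. -/
def affineSpace (σ : Type*) : SpaceWithFunctions (σ → ℂ) where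
  top := zariskiTopology σ
  IsRegular U f := ∀ x ∈ U, ∃ p q : MvPolynomial σ ℂ, MvPolynomial.eval x q ≠ 0 ∧
    ∀ y ∈ U, MvPolynomial.eval y q ≠ 0 → f y = MvPolynomial.eval y p / MvPolynomial.eval y q
  congr := by
    intro U f g _ hfg hf x hx
    obtain ⟨p, q, hq, h⟩ := hf x hx
    exact ⟨p, q, hq, fun y hy hy' => by rw [← hfg hy, h y hy hy']⟩
  mono := by
    intro U V f _ _ hVU hf x hx
    obtain ⟨p, q, hq, h⟩ := hf x (hVU hx)
    exact ⟨p, q, hq, fun y hy hy' => h y (hVU hy) hy'⟩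
  glue := by
    intro U f _ h x hx
    obtain ⟨V, hV, hxV, -, hf⟩ := h x hx
    obtain ⟨p, q, hq, h'⟩ := hf x hxV
    obtain ⟨r, hr, hrV⟩ := hV x hxV
    refine ⟨p * r, q * r, by simp [hq, hr], fun y _ hy => ?_⟩
    rw [map_mul] at hy
    have hry := right_ne_zero_of_mul hy
    rw [map_mul, map_mul, mul_div_mul_right _ _ hry]
    exact h' y (hrV y hry) (left_ne_zero_of_mul hy)
  const := fun c _ x _ => ⟨MvPolynomial.C c, 1, by simp, fun y _ _ => by simp⟩
  add := by
    intro U f g _ hf hg x hx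
    obtain ⟨p, q, hq, h⟩ := hf x hx
    obtain ⟨p', q', hq', h'⟩ := hg x hx
    refine ⟨p * q' + q * p', q * q', by simp [hq, hq'], fun y hyU hy => ?_⟩
    rw [map_mul] at hy
    have h1 := left_ne_zero_of_mul hy
    have h2 := right_ne_zero_of_mul hy
    simp only [h y hyU h1, h' y hyU h2, map_add, map_mul]
    rw [div_add_div _ _ h1 h2]
  mul := by
    intro U f g _ hf hg x hx
    obtain ⟨p, q, hq, h⟩ := hf x hx
    obtain ⟨p', q', hq', h'⟩ := hg x hx
    refine ⟨p * p', q * q', by simp [hq, hq'], fun y hyU hy => ?_⟩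
    rw [map_mul] at hy
    have h1 := left_ne_zero_of_mul hy
    have h2 := right_ne_zero_of_mul hy
    simp only [h y hyU h1, h' y hyU h2, map_mul]
    rw [div_mul_div_comm]
  isOpen_ne_zero := by
    rintro U f hU hf x ⟨hx, hfx⟩
    obtain ⟨p, q, hq, h⟩ := hf x hx
    obtain ⟨r, hr, hrU⟩ := hU x hx
    have hp : MvPolynomial.eval x p ≠ 0 := fun h0 => hfx (by rw [h x hx hq, h0, zero_div])
    refine ⟨p * q * r, by simp [hp, hq, hr], fun y hy => ?_⟩
    rw [map_mul, map_mul] at hy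
    have h1 := left_ne_zero_of_mul (left_ne_zero_of_mul hy)
    have h2 := right_ne_zero_of_mul (left_ne_zero_of_mul hy)
    have h3 := hrU y (right_ne_zero_of_mul hy)
    exact ⟨h3, by rw [h y h3 h2]; exact div_ne_zero h1 h2⟩
  inv := by
    rintro U f _ hf x ⟨hx, hfx⟩
    obtain ⟨p, q, hq, h⟩ := hf x hx
    have hp : MvPolynomial.eval x p ≠ 0 := fun h0 => hfx (by rw [h x hx hq, h0, zero_div])
    refine ⟨q * q, p * q, by simp [hp, hq], fun y hy hy' => ?_⟩
    rw [map_mul] at hy'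
    have h2 := right_ne_zero_of_mul hy'
    simp only [h y hy.1 h2, map_mul, inv_div]
    rw [mul_div_mul_right _ _ h2]

/-- The structure induced on a subset `Y` (for a locally closed `Y`, the reduced subvariety): the
subspace topology, the regular functions being locally restrictions of regular functions. -/
def restrict {X : Type*} (A : SpaceWithFunctions X) (Y : Set X) : SpaceWithFunctions Y where
  top := A.top.induced Subtype.val
  IsRegular U f := ∀ y ∈ U, ∃ V : Set X, IsOpen[A.top] V ∧ (y : X) ∈ V ∧ ∃ g : X → ℂ,
    A.IsRegular V g ∧ ∀ z : Y, z ∈ U → (z : X) ∈ V → f z = g z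
  congr := by
    intro U f g _ hfg hf y hy
    obtain ⟨V, hV, hyV, k, hk, h⟩ := hf y hy
    exact ⟨V, hV, hyV, k, hk, fun z hz hzV => by rw [← hfg hz, h z hz hzV]⟩
  mono := by
    intro U W f _ _ hWU hf y hy
    obtain ⟨V, hV, hyV, k, hk, h⟩ := hf y (hWU hy)
    exact ⟨V, hV, hyV, k, hk, fun z hz hzV => h z (hWU hz) hzV⟩
  glue := by
    intro U f _ hf y hy
    obtain ⟨W, ⟨W', hW', rfl⟩, hyW, -, hfW⟩ := hf y hy
    obtain ⟨V, hV, hyV, k, hk, h⟩ := hfW y hyW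
    have hVW : IsOpen[A.top] (V ∩ W') := @IsOpen.inter _ A.top _ _ hV hW'
    exact ⟨V ∩ W', hVW, ⟨hyV, hyW⟩, k, A.mono hV hVW Set.inter_subset_left hk,
      fun z _ hzV => h z hzV.2 hzV.1⟩
  const := fun c _ y _ => ⟨Set.univ, @isOpen_univ _ A.top, trivial, fun _ => c,
    A.const c (@isOpen_univ _ A.top), fun _ _ _ => rfl⟩
  add := by
    intro U f g _ hf hg y hy
    obtain ⟨V, hV, hyV, k, hk, h⟩ := hf y hy
    obtain ⟨V', hV', hyV', k', hk', h'⟩ := hg y hy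
    have hVV : IsOpen[A.top] (V ∩ V') := @IsOpen.inter _ A.top _ _ hV hV'
    exact ⟨V ∩ V', hVV, ⟨hyV, hyV'⟩, _,
      A.add hVV (A.mono hV hVV Set.inter_subset_left hk)
        (A.mono hV' hVV Set.inter_subset_right hk'),
      fun z hz hzV => by simp only [h z hz hzV.1, h' z hz hzV.2]⟩
  mul := by
    intro U f g _ hf hg y hy
    obtain ⟨V, hV, hyV, k, hk, h⟩ := hf y hy
    obtain ⟨V', hV', hyV', k', hk', h'⟩ := hg y hy
    have hVV : IsOpen[A.top] (V ∩ V') := @IsOpen.inter _ A.top _ _ hV hV'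
    exact ⟨V ∩ V', hVV, ⟨hyV, hyV'⟩, _,
      A.mul hVV (A.mono hV hVV Set.inter_subset_left hk)
        (A.mono hV' hVV Set.inter_subset_right hk'),
      fun z hz hzV => by simp only [h z hz hzV.1, h' z hz hzV.2]⟩
  isOpen_ne_zero := by
    rintro _ f ⟨U, hU, rfl⟩ hf
    let _ := A.top
    rw [isOpen_iff_mem_nhds]
    rintro y ⟨hy, hfy⟩
    obtain ⟨V, hV, hyV, k, hk, h⟩ := hf y hy
    have hO : IsOpen (U ∩ {x | x ∈ V ∧ k x ≠ 0}) := IsOpen.inter hU (A.isOpen_ne_zero hV hk)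
    refine Filter.mem_of_superset ((hO.preimage continuous_subtype_val).mem_nhds
      ⟨hy, hyV, by rwa [h y hy hyV] at hfy⟩) ?_
    rintro z ⟨hzU, hzV, hkz⟩
    exact ⟨hzU, by rwa [h z hzU hzV]⟩
  inv := by
    rintro U f _ hf y ⟨hy, hfy⟩
    obtain ⟨V, hV, hyV, k, hk, h⟩ := hf y hy
    refine ⟨_, A.isOpen_ne_zero hV hk, ⟨hyV, by rwa [h y hy hyV] at hfy⟩, _, A.inv hV hk, ?_⟩
    rintro z ⟨hz, -⟩ ⟨hzV, -⟩
    simp only [h z hz hzV]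

/-- The quotient by an equivalence relation: the quotient topology, and the functions whose
pullback is regular.  For the orbit relation of a group action this is the defining structure of
the geometric quotient (regular functions on `U` are the invariant regular functions on the
preimage of `U`). -/
def quotient {X : Type*} (A : SpaceWithFunctions X) (s : Setoid X) :
    SpaceWithFunctions (Quotient s) where
  top := A.top.coinduced (Quotient.mk s)
  IsRegular U f := A.IsRegular (Quotient.mk s ⁻¹' U) (f ∘ Quotient.mk s)
  congr := fun hU hfg hf => A.congr hU (fun _ hx => hfg hx) hf
  mono := fun hU hV hVU hf => A.mono hU hV (Set.preimage_mono hVU) hf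
  glue := by
    intro U f hU h
    refine A.glue hU fun x hx => ?_
    obtain ⟨V, hV, hxV, hVU, hf⟩ := h _ hx
    exact ⟨_, hV, hxV, Set.preimage_mono hVU, hf⟩
  const := fun c hU => A.const c hU
  add := fun hU hf hg => A.add hU hf hg
  mul := fun hU hf hg => A.mul hU hf hg
  isOpen_ne_zero := fun hU hf => A.isOpen_ne_zero hU hf
  inv := fun hU hf => A.inv hU hf

/-- Isomorphism of spaces with functions: a homeomorphism identifying the regular functions. -/
def Isomorphic {X Y : Type*} (A : SpaceWithFunctions X) (B : SpaceWithFunctions Y) : Prop :=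
  ∃ φ : X ≃ Y, (∀ U : Set Y, IsOpen[B.top] U ↔ IsOpen[A.top] (φ ⁻¹' U)) ∧
    ∀ U : Set Y, IsOpen[B.top] U → ∀ f : Y → ℂ,
      B.IsRegular U f ↔ A.IsRegular (φ ⁻¹' U) (f ∘ φ)

/-- `∅ = V 0 ⊆ V 1 ⊆ ⋯ ⊆ V r = X` is a filtration by open subsets whose successive differences are
affine spaces. -/
structure IsCellDecomposition {X : Type*} (A : SpaceWithFunctions X) {r : ℕ}
    (V : Fin (r + 1) → Set X) : Prop where
  zero : V 0 = ∅
  last : V (Fin.last r) = Set.univ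
  subset : ∀ k : Fin r, V k.castSucc ⊆ V k.succ
  isOpen : ∀ k, IsOpen[A.top] (V k)
  affine : ∀ k : Fin r, ∃ n : ℕ,
    Isomorphic (A.restrict (V k.succ \ V k.castSucc)) (affineSpace (Fin n))

end SpaceWithFunctions

/-! ## Framed quivers, the tree of paths -/

/-- The vertices of the framed quiver: those of `Q` and a new vertex `∞`. -/
inductive FramedVertex {I : Type u} (w : I → ℕ) : Type u
  | infty : FramedVertex w
  | base (i : I) : FramedVertex w

/-- The arrows of the framed quiver: those of `Q` and `w i` arrows `∞ → i` for every vertex `i`. -/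
inductive FramedArrow {I : Type u} [Quiver.{v} I] (w : I → ℕ) :
    FramedVertex w → FramedVertex w → Type (max u v)
  | frame (i : I) (k : Fin (w i)) : FramedArrow w .infty (.base i)
  | arrow {i j : I} (a : i ⟶ j) : FramedArrow w (.base i) (.base j)

instance FramedVertex.instQuiver {I : Type u} [Quiver.{v} I] (w : I → ℕ) :
    Quiver.{max u v} (FramedVertex w) :=
  ⟨FramedArrow w⟩

/-- The set of paths in the framed quiver that start at `∞`. -/
structure RootedPath {I : Type u} [Quiver.{v} I] (w : I → ℕ) : Type (max u v) where
  target : FramedVertex w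
  path : Quiver.Path (FramedVertex.infty : FramedVertex w) target

namespace RootedPath

variable {I : Type u} [Quiver.{v} I] {w : I → ℕ}

/-- The partial order `u ⪯ v` on paths: `v` is `u` followed by some path. -/
def Prefix (u v : RootedPath w) : Prop :=
  ∃ q : Quiver.Path u.target v.target, u.path.comp q = v.path

/-- A total order on the set of paths is admissible if it extends the partial order `⪯`. -/
def Admissible (w : I → ℕ) [LinearOrder (RootedPath w)] : Prop :=
  ∀ u v : RootedPath w, Prefix u v → u ≤ v

/-- A finite subtree: a nonempty finite lower set for `⪯`. -/
def IsSubtree (S : Finset (RootedPath w)) : Prop :=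
  S.Nonempty ∧ ∀ v ∈ S, ∀ u, Prefix u v → u ∈ S

/-- The set `P(d)` of the finite subtrees with dimension vector `d`. -/
def treesOfDim (d : I → ℕ) : Set (Finset (RootedPath w)) :=
  {S | IsSubtree S ∧ ∀ i : I, {u | u ∈ S ∧ u.target = .base i}.ncard = d i}

/-- The critical set of `S`: the `⪯`-minimal elements of the complement of `S`. -/
def criticalSet (S : Finset (RootedPath w)) : Set (RootedPath w) :=
  {v | v ∉ S ∧ ∀ u, Prefix u v → u ≠ v → u ∈ S}

/-- Write `S' = (v'_1 < v'_2 < ⋯)` and `S = (v_1 < v_2 < ⋯)`; then `S' < S` means that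
`v'_i < v_i` at the first place `i` where the two sequences differ. -/
def TreeLT [LinearOrder (RootedPath w)] (S' S : Finset (RootedPath w)) : Prop :=
  ∃ i : ℕ, (∀ j < i, S'.sort[j]? = S.sort[j]?) ∧
    ∃ a b, S'.sort[i]? = some a ∧ S.sort[i]? = some b ∧ a < b

def TreeLE [LinearOrder (RootedPath w)] (S' S : Finset (RootedPath w)) : Prop :=
  S' = S ∨ TreeLT S' S

end RootedPath

/-! ## Framed representations and the noncommutative Hilbert scheme -/

/-- Matrix entries of a framed representation of dimension vector `d`. -/
inductive FramedRepCoord {I : Type u} [Quiver.{v} I] (w d : I → ℕ) : Type (max u v)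
  | arrow {i j : I} (a : i ⟶ j) (k : Fin (d j)) (l : Fin (d i)) : FramedRepCoord w d
  | frame (i : I) (k : Fin (d i)) (l : Fin (w i)) : FramedRepCoord w d

/-- The affine space `⨁_{a : i → j} Hom(ℂ^{d i}, ℂ^{d j}) ⊕ ⨁_i Hom(ℂ^{w i}, ℂ^{d i})`, in matrix
coordinates. -/
def FramedRep {I : Type u} [Quiver.{v} I] (w d : I → ℕ) : Type (max u v) :=
  FramedRepCoord w d → ℂ

namespace FramedRep

variable {I : Type u} [Quiver.{v} I] {w d : I → ℕ}

def arrowMatrix (M : FramedRep w d) {i j : I} (a : i ⟶ j) : Matrix (Fin (d j)) (Fin (d i)) ℂ :=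
  Matrix.of fun k l => M (.arrow a k l)

def frameMatrix (M : FramedRep w d) (i : I) : Matrix (Fin (d i)) (Fin (w i)) ℂ :=
  Matrix.of fun k l => M (.frame i k l)

/-- The dimension vector on the framed quiver, with value `1` at `∞`. -/
def dimAt (d : I → ℕ) : FramedVertex w → ℕ
  | .infty => 1
  | .base i => d i

/-- The vector space `M_x` of a framed representation at the vertex `x` (so `M_∞ = ℂ`). -/
abbrev Space (w d : I → ℕ) (x : FramedVertex w) : Type :=
  Fin (dimAt d x) → ℂ

/-- The linear maps of the corresponding representation of the framed quiver; the `k`-th arrow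
`∞ → i` sends `1` to the `k`-th column of the matrix `ℂ^{w i} → ℂ^{d i}`. -/
noncomputable def act (M : FramedRep w d) : {x y : FramedVertex w} → FramedArrow w x y →
    (Space w d x →ₗ[ℂ] Space w d y)
  | _, _, .frame i k =>
      { toFun := fun v l => v (0 : Fin 1) * M.frameMatrix i l k
        map_add' := fun v v' => funext fun _ => add_mul (v (0 : Fin 1)) (v' (0 : Fin 1)) _
        map_smul' := fun c v => funext fun _ => mul_assoc c (v (0 : Fin 1)) _ }
  | _, _, .arrow a => (M.arrowMatrix a).mulVecLin

/-- Stability: `M` is generated by `M_∞` as a representation of the framed quiver, that is, the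
only subrepresentation containing `M_∞` is `M`. -/
def IsStable (M : FramedRep w d) : Prop :=
  ∀ L : (x : FramedVertex w) → Submodule ℂ (Space w d x),
    (∀ (x y : FramedVertex w) (a : FramedArrow w x y), (L x).map (M.act a) ≤ L y) →
      L .infty = ⊤ → ∀ x, L x = ⊤

/-- The group `G_d = ∏_i GL_{d i}(ℂ)`. -/
abbrev GaugeGroup (d : I → ℕ) : Type u :=
  (i : I) → Matrix.GeneralLinearGroup (Fin (d i)) ℂ

/-- The action of `G_d` by change of bases: `a ↦ g_j a g_i⁻¹` for an arrow `a : i → j`, and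
`f ↦ g_i f` for the framing `f : ℂ^{w i} → ℂ^{d i}`. -/
noncomputable def gauge (g : GaugeGroup d) (M : FramedRep w d) : FramedRep w d
  | .arrow (i := i) (j := j) a k l =>
      ((g j : Matrix (Fin (d j)) (Fin (d j)) ℂ) * M.arrowMatrix a *
        ((g i)⁻¹ : Matrix.GeneralLinearGroup (Fin (d i)) ℂ).val) k l
  | .frame i k l => ((g i : Matrix (Fin (d i)) (Fin (d i)) ℂ) * M.frameMatrix i) k l

theorem arrowMatrix_gauge (g : GaugeGroup d) (M : FramedRep w d) {i j : I} (a : i ⟶ j) :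
    (gauge g M).arrowMatrix a = (g j).val * M.arrowMatrix a * ((g i)⁻¹).val := rfl

theorem frameMatrix_gauge (g : GaugeGroup d) (M : FramedRep w d) (i : I) :
    (gauge g M).frameMatrix i = (g i).val * M.frameMatrix i := rfl

theorem ext_matrix {M N : FramedRep w d}
    (h : ∀ (i j : I) (a : i ⟶ j), M.arrowMatrix a = N.arrowMatrix a)
    (h' : ∀ i, M.frameMatrix i = N.frameMatrix i) : M = N := by
  funext c
  cases c with
  | arrow a k l => exact congrFun (congrFun (h _ _ a) k) l
  | frame i k l => exact congrFun (congrFun (h' i) k) l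

noncomputable instance instMulAction : MulAction (GaugeGroup d) (FramedRep w d) where
  smul := gauge
  one_smul M := by
    refine ext_matrix (fun i j a => ?_) (fun i => ?_)
    · change (gauge 1 M).arrowMatrix a = _
      rw [arrowMatrix_gauge]
      simp
    · change (gauge 1 M).frameMatrix i = _
      rw [frameMatrix_gauge]
      simp
  mul_smul g h M := by
    refine ext_matrix (fun i j a => ?_) (fun i => ?_)
    · change (gauge (g * h) M).arrowMatrix a = (gauge g (gauge h M)).arrowMatrix a
      simp only [arrowMatrix_gauge, Pi.mul_apply, mul_inv_rev, Units.val_mul, Matrix.mul_assoc]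
    · change (gauge (g * h) M).frameMatrix i = (gauge g (gauge h M)).frameMatrix i
      simp only [frameMatrix_gauge, Pi.mul_apply, Units.val_mul, Matrix.mul_assoc]

/-- The vector `m_u = u m_* ∈ M_{t(u)}`, where `m_* = 1 ∈ M_∞`. -/
noncomputable def pathVector (M : FramedRep w d) : {x : FramedVertex w} →
    Quiver.Path (FramedVertex.infty : FramedVertex w) x → Space w d x
  | _, .nil => fun _ => 1
  | _, .cons p a => M.act a (M.pathVector p)

open Classical in
/-- The vector `m_u` as an element of the total space `M = ⨁_x M_x`. -/
noncomputable def vec (M : FramedRep w d) (u : RootedPath w) :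
    (x : FramedVertex w) → Space w d x :=
  Pi.single u.target (M.pathVector u.path)

end FramedRep

/-- The stable framed representations of dimension vector `d`. -/
def StableRep {I : Type u} [Quiver.{v} I] (w d : I → ℕ) : Set (FramedRep w d) :=
  {M | M.IsStable}

/-- The orbit relation of `G_d` on the stable framed representations. -/
noncomputable def stableRepSetoid {I : Type u} [Quiver.{v} I] (w d : I → ℕ) : Setoid (StableRep w d) :=
  (MulAction.orbitRel (FramedRep.GaugeGroup d) (FramedRep w d)).comap Subtype.val

/-- The set of points of the noncommutative Hilbert scheme `N_d`: the orbits of `G_d` on the stable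
framed representations of dimension vector `d`. -/
noncomputable def NCHilb {I : Type u} [Quiver.{v} I] (w d : I → ℕ) : Type (max u v) :=
  Quotient (stableRepSetoid w d)

namespace NCHilb

variable {I : Type u} [Quiver.{v} I]

/-- The isomorphism class of a stable framed representation. -/
noncomputable def mk {w d : I → ℕ} (M : StableRep w d) : NCHilb w d :=
  Quotient.mk (stableRepSetoid w d) M

/-- The variety structure of the noncommutative Hilbert scheme: the quotient by `G_d` of the
stable locus of the affine space of framed representations. -/
noncomputable def variety (w d : I → ℕ) : SpaceWithFunctions (NCHilb w d) :=
  ((SpaceWithFunctions.affineSpace (FramedRepCoord w d)).restrict (StableRep w d)).quotient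
    (stableRepSetoid w d)

variable {w : I → ℕ}

/-- `U_S`: the vectors `m_u`, `u ∈ S`, form a basis of `M`. -/
def openChart (d : I → ℕ) (S : Finset (RootedPath w)) : Set (NCHilb w d) :=
  mk '' {M | LinearIndependent ℂ (fun u : S => M.1.vec u.1) ∧
    Submodule.span ℂ (M.1.vec '' (S : Set (RootedPath w))) = ⊤}

/-- `Z_S ⊆ U_S`: moreover `m_v` lies in the span of the `m_u`, `u ∈ S`, `u < v`, for every `v` in
the critical set of `S`. -/
def cell [LinearOrder (RootedPath w)] (d : I → ℕ) (S : Finset (RootedPath w)) :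
    Set (NCHilb w d) :=
  mk '' {M | (LinearIndependent ℂ (fun u : S => M.1.vec u.1) ∧
      Submodule.span ℂ (M.1.vec '' (S : Set (RootedPath w))) = ⊤) ∧
    ∀ v ∈ RootedPath.criticalSet S, M.1.vec v ∈ Submodule.span ℂ (M.1.vec '' {u | u ∈ S ∧ u < v})}

/-- `V_S`: the union of the `U_{S'}` over all `S' ≤ S` in `P(d)`. -/
def openUnion [LinearOrder (RootedPath w)] (d : I → ℕ) (S : Finset (RootedPath w)) :
    Set (NCHilb w d) :=
  ⋃ S' ∈ {S' | S' ∈ RootedPath.treesOfDim d ∧ RootedPath.TreeLE S' S}, openChart d S'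

end NCHilb

/-! The argument is Gaussian elimination along the tree of paths. Let `M` be stable and `T` a tree
whose vectors m_u do not span `M`. Some critical path of `T` has its vector outside the span, since
otherwise the span would be closed under all arrows and contain M_∞
(`exists_criticalSet_notMem_span`). Hence every independent tree grows to a tree indexing a basis
(`exists_isTreeBasis`), and counting dimensions vertex by vertex puts that tree in P(d).

The cell Z_S consists of the `M` for which `S` is the least tree indexing a basis. If `M` lies in
Z_S and S' < S, the first path of S' missing from `S` is critical for `S`, and the cell condition
makes the vectors of S' dependent (`IsCellular.not_treeLT`). If instead the condition fails at a
critical `v`, the part of `S` below `v` together with `v` extends to a smaller basis tree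
(`IsTreeBasis.exists_treeLT`). Since P(d) is finite, existence and uniqueness of the least tree give
the disjointness, the covering and the description of V_S by cells.

For the geometry, U_S is the nonvanishing locus of determinants, hence open. Each of its orbits has
a unique normalized representative, in which the m_u, u ∈ S, are standard bases; its entries are
regular on U_S by Cramer's rule. In a normalized representation every matrix column is the vector of
a path in `S`, hence prescribed, or of a critical path. On the latter the cell condition kills
exactly the entries whose row label does not precede the path, and the others are free
(`IsNormalized.eq_cellRep`, `isCellular_cellRep`). The free entries and the polynomial family
`cellRep` give mutually inverse morphisms between Z_S and an affine space, and the successive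
differences of the filtration are the cells. -/

/-! ## Morphisms of spaces with functions -/

namespace SpaceWithFunctions

variable {X Y Z : Type*}

/-- A morphism of spaces with functions: a continuous map that pulls back regular functions to
regular functions. -/
structure IsMorphism (A : SpaceWithFunctions X) (B : SpaceWithFunctions Y) (φ : X → Y) : Prop where
  isOpen_preimage : ∀ {U : Set Y}, IsOpen[B.top] U → IsOpen[A.top] (φ ⁻¹' U)
  isRegular_comp : ∀ {U : Set Y} {f : Y → ℂ}, IsOpen[B.top] U → B.IsRegular U f →
    A.IsRegular (φ ⁻¹' U) (f ∘ φ)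

theorem IsMorphism.comp {A : SpaceWithFunctions X} {B : SpaceWithFunctions Y}
    {C : SpaceWithFunctions Z} {ψ : Y → Z} {φ : X → Y} (hψ : IsMorphism B C ψ)
    (hφ : IsMorphism A B φ) : IsMorphism A C (ψ ∘ φ) :=
  ⟨fun hU => hφ.isOpen_preimage (hψ.isOpen_preimage hU),
    fun hU hf => hφ.isRegular_comp (hψ.isOpen_preimage hU) (hψ.isRegular_comp hU hf)⟩

theorem isMorphism_mk (A : SpaceWithFunctions X) (s : Setoid X) :
    IsMorphism A (A.quotient s) (Quotient.mk s) :=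
  ⟨fun hU => hU, fun _ hf => hf⟩

/-- A regular function on `T` is only locally the restriction of an ambient regular function, so the
local extensions are pulled back and glued in `A`. -/
theorem IsMorphism.codRestrict {A : SpaceWithFunctions X} {B : SpaceWithFunctions Y} {φ : X → Y}
    (hφ : IsMorphism A B φ) (T : Set Y) (hT : ∀ x, φ x ∈ T) :
    IsMorphism A (B.restrict T) (Set.codRestrict φ T hT) where
  isOpen_preimage := by
    rintro _ ⟨U, hU, rfl⟩
    exact hφ.isOpen_preimage hU
  isRegular_comp := by
    rintro _ f ⟨U, hU, rfl⟩ hf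
    refine A.glue (hφ.isOpen_preimage hU) fun x hx => ?_
    obtain ⟨V, hV, hxV, g, hg, h⟩ := hf _ hx
    have hVU : IsOpen[A.top] (φ ⁻¹' V ∩ φ ⁻¹' U) :=
      @IsOpen.inter _ A.top _ _ (hφ.isOpen_preimage hV) (hφ.isOpen_preimage hU)
    refine ⟨_, hVU, ⟨hxV, hx⟩, Set.inter_subset_right, ?_⟩
    refine A.congr hVU (fun z hz => (h (Set.codRestrict φ T hT z) hz.2 hz.1).symm) ?_
    exact A.mono (hφ.isOpen_preimage hV) hVU Set.inter_subset_left (hφ.isRegular_comp hV hg)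

theorem restrict_isRegular_comp_val (A : SpaceWithFunctions X) {T W : Set X}
    (hW : IsOpen[A.top] W) (hTW : T ⊆ W) {f : X → ℂ} (hf : A.IsRegular W f) :
    (A.restrict T).IsRegular Set.univ (fun x => f x) :=
  fun y _ => ⟨W, hW, hTW y.2, f, hf, fun _ _ _ => rfl⟩

theorem isRegular_eval (A : SpaceWithFunctions X) {σ : Type*} {φ : X → σ → ℂ}
    (hφ : ∀ c, A.IsRegular Set.univ (fun x => φ x c)) (p : MvPolynomial σ ℂ) :
    A.IsRegular Set.univ (fun x => MvPolynomial.eval (φ x) p) := by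
  have huniv : IsOpen[A.top] Set.univ := @isOpen_univ _ A.top
  induction p using MvPolynomial.induction_on with
  | C a => simpa using A.const a huniv
  | add p q hp hq => simpa using A.add huniv hp hq
  | mul_X p c hp => simpa using A.mul huniv hp (hφ c)

/-- A map to an affine space is a morphism if its coordinates are regular functions. -/
theorem isMorphism_affineSpace (A : SpaceWithFunctions X) {σ : Type*} {φ : X → σ → ℂ}
    (hφ : ∀ c, A.IsRegular Set.univ (fun x => φ x c)) :
    IsMorphism A (affineSpace σ) φ := by
  have huniv : IsOpen[A.top] Set.univ := @isOpen_univ _ A.top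
  have hne : ∀ q : MvPolynomial σ ℂ, IsOpen[A.top] {x | x ∈ Set.univ ∧
      MvPolynomial.eval (φ x) q ≠ 0} := fun q => A.isOpen_ne_zero huniv (isRegular_eval A hφ q)
  have hopen : ∀ {U : Set (σ → ℂ)}, IsOpen[(affineSpace σ).top] U → IsOpen[A.top] (φ ⁻¹' U) := by
    intro U hU
    refine (@isOpen_iff_forall_mem_open _ A.top _).2 fun x hx => ?_
    obtain ⟨q, hq, h⟩ := hU _ hx
    exact ⟨_, fun y hy => h _ hy.2, hne q, trivial, hq⟩
  refine ⟨hopen, fun {U f} hU hf => A.glue (hopen hU) fun x hx => ?_⟩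
  obtain ⟨p, q, hq, h⟩ := hf _ hx
  have hV : IsOpen[A.top] (φ ⁻¹' U ∩ {x | x ∈ Set.univ ∧ MvPolynomial.eval (φ x) q ≠ 0}) :=
    @IsOpen.inter _ A.top _ _ (hopen hU) (hne q)
  refine ⟨_, hV, ⟨hx, trivial, hq⟩, Set.inter_subset_left, ?_⟩
  refine A.congr hV (f := fun x => MvPolynomial.eval (φ x) p * (MvPolynomial.eval (φ x) q)⁻¹)
    (fun y hy => ?_) ?_
  · rw [Function.comp_apply, h _ hy.1 hy.2.2, div_eq_mul_inv]
  · exact A.mul hV (A.mono huniv hV (Set.subset_univ _) (isRegular_eval A hφ p))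
      (A.mono (hne q) hV Set.inter_subset_right (A.inv huniv (isRegular_eval A hφ q)))

theorem affineSpace_isRegular_eval {σ : Type*} (p : MvPolynomial σ ℂ) (U : Set (σ → ℂ)) :
    (affineSpace σ).IsRegular U (fun x => MvPolynomial.eval x p) :=
  fun _ _ => ⟨p, 1, by simp, fun _ _ _ => by simp⟩

theorem affineSpace_isRegular_div {σ : Type*} (p q : MvPolynomial σ ℂ) {U : Set (σ → ℂ)}
    (hU : ∀ x ∈ U, MvPolynomial.eval x q ≠ 0) :
    (affineSpace σ).IsRegular U (fun x => MvPolynomial.eval x p / MvPolynomial.eval x q) :=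
  fun x hx => ⟨p, q, hU x hx, fun _ _ _ => rfl⟩

theorem isOpen_eval_ne_zero {σ : Type*} (q : MvPolynomial σ ℂ) :
    IsOpen[(affineSpace σ).top] {x | MvPolynomial.eval x q ≠ 0} :=
  fun _ hx => ⟨q, hx, fun _ hy => hy⟩

/-- Pulling back along the inverse supplies the reverse implication in both equivalences. -/
theorem Isomorphic.of_isMorphism {A : SpaceWithFunctions X} {B : SpaceWithFunctions Y}
    (φ : X ≃ Y) (hφ : IsMorphism A B φ) (hφ' : IsMorphism B A φ.symm) : Isomorphic A B := by
  have hpre : ∀ U : Set Y, φ.symm ⁻¹' (φ ⁻¹' U) = U := fun U => by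
    rw [← Set.preimage_comp, φ.self_comp_symm, Set.preimage_id]
  refine ⟨φ, fun U => ⟨hφ.isOpen_preimage, fun h => ?_⟩, fun U hU f => ⟨hφ.isRegular_comp hU,
    fun h => ?_⟩⟩
  · rw [← hpre U]
    exact hφ'.isOpen_preimage h
  · have := hφ'.isRegular_comp (hφ.isOpen_preimage hU) h
    rwa [hpre, Function.comp_assoc, φ.self_comp_symm, Function.comp_id] at this

theorem isMorphism_affineSpace_comp {σ τ : Type*} (g : τ → σ) :
    IsMorphism (affineSpace σ) (affineSpace τ) (fun x c => x (g c)) :=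
  isMorphism_affineSpace _ fun c => by
    simpa using affineSpace_isRegular_eval (MvPolynomial.X (g c)) Set.univ

/-- Every affine space of finite dimension is isomorphic to some `𝔸ⁿ`. -/
theorem isomorphic_affineSpace_fin {σ : Type*} [Finite σ] {A : SpaceWithFunctions X}
    (φ : X ≃ (σ → ℂ)) (hφ : IsMorphism A (affineSpace σ) φ)
    (hφ' : IsMorphism (affineSpace σ) A φ.symm) :
    ∃ n : ℕ, Isomorphic A (affineSpace (Fin n)) := by
  obtain ⟨n, ⟨e⟩⟩ := Finite.exists_equiv_fin σ
  refine ⟨n, .of_isMorphism (φ.trans (e.arrowCongr (Equiv.refl ℂ))) ?_ ?_⟩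
  · exact (isMorphism_affineSpace_comp e.symm).comp hφ
  · exact hφ'.comp (isMorphism_affineSpace_comp e)

/-! ### Polynomial functions -/

/-- Functions on the affine space given by a polynomial. -/
noncomputable def polynomialFunctions (σ : Type*) : Subalgebra ℂ ((σ → ℂ) → ℂ) :=
  (AlgHom.pi fun x => MvPolynomial.aeval x).range

theorem mem_polynomialFunctions {σ : Type*} {f : (σ → ℂ) → ℂ} :
    f ∈ polynomialFunctions σ ↔ ∃ p : MvPolynomial σ ℂ, ∀ x, f x = MvPolynomial.eval x p := by
  constructor
  · rintro ⟨p, rfl⟩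
    exact ⟨p, fun x => by simp [MvPolynomial.aeval_eq_eval]⟩
  · rintro ⟨p, h⟩
    exact ⟨p, funext fun x => by simp [MvPolynomial.aeval_eq_eval, h]⟩

theorem coord_mem_polynomialFunctions {σ : Type*} (c : σ) :
    (fun x : σ → ℂ => x c) ∈ polynomialFunctions σ :=
  mem_polynomialFunctions.2 ⟨.X c, fun x => by simp⟩

theorem isRegular_of_mem_polynomialFunctions {σ : Type*} {f : (σ → ℂ) → ℂ}
    (hf : f ∈ polynomialFunctions σ) (U : Set (σ → ℂ)) : (affineSpace σ).IsRegular U f := by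
  obtain ⟨p, hp⟩ := mem_polynomialFunctions.1 hf
  rw [funext hp]
  exact affineSpace_isRegular_eval p U

theorem mul_apply_mem_polynomialFunctions {σ l m n : Type*} [Fintype m]
    {A : (σ → ℂ) → Matrix l m ℂ} {B : (σ → ℂ) → Matrix m n ℂ}
    (hA : ∀ i j, (fun x => A x i j) ∈ polynomialFunctions σ)
    (hB : ∀ i j, (fun x => B x i j) ∈ polynomialFunctions σ) (i : l) (k : n) :
    (fun x => (A x * B x) i k) ∈ polynomialFunctions σ := by
  have : (fun x => (A x * B x) i k) = ∑ j, (fun x => A x i j) * fun x => B x j k := by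
    funext x
    rw [Finset.sum_apply]
    rfl
  rw [this]
  exact sum_mem fun j _ => mul_mem (hA i j) (hB j k)

theorem det_mem_polynomialFunctions {σ n : Type*} [Fintype n] [DecidableEq n]
    {A : (σ → ℂ) → Matrix n n ℂ} (hA : ∀ k l, (fun x => A x k l) ∈ polynomialFunctions σ) :
    (fun x => (A x).det) ∈ polynomialFunctions σ := by
  have : (fun x => (A x).det) = ∑ π : Equiv.Perm n, algebraMap ℂ ((σ → ℂ) → ℂ)
      ((Equiv.Perm.sign π : ℤ) : ℂ) * ∏ i, (fun x => A x (π i) i) := by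
    funext x
    simp [Matrix.det_apply', Finset.sum_apply, Finset.prod_apply]
  rw [this]
  exact sum_mem fun π _ => mul_mem (Subalgebra.algebraMap_mem _ _)
    (prod_mem fun i _ => hA _ _)

/-- Each entry is the determinant of the matrix with one row replaced by a constant unit vector. -/
theorem adjugate_mem_polynomialFunctions {σ n : Type*} [Fintype n] [DecidableEq n]
    {A : (σ → ℂ) → Matrix n n ℂ} (hA : ∀ k l, (fun x => A x k l) ∈ polynomialFunctions σ) (k l : n) :
    (fun x => (A x).adjugate k l) ∈ polynomialFunctions σ := by
  simp only [Matrix.adjugate_apply]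
  refine det_mem_polynomialFunctions fun i j => ?_
  by_cases h : i = l
  · subst h
    simp only [Matrix.updateRow_self]
    exact Subalgebra.algebraMap_mem _ (Pi.single (M := fun _ : n => ℂ) k 1 j)
  · simp only [Matrix.updateRow_ne h]
    exact hA i j

end SpaceWithFunctions

/-! ## Trees of paths and their order -/

namespace RootedPath

variable {I : Type u} [Quiver.{v} I] {w : I → ℕ}

theorem isEmpty_framedArrow_infty (x : FramedVertex w) : IsEmpty (FramedArrow w x .infty) :=
  ⟨fun a => nomatch a⟩

/-- The trivial path at `∞`. -/
def root (w : I → ℕ) : RootedPath w := ⟨.infty, .nil⟩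

/-- The path `u` followed by the arrow `a`. -/
def snoc (u : RootedPath w) {y : FramedVertex w} (a : FramedArrow w u.target y) : RootedPath w :=
  ⟨y, u.path.cons a⟩

theorem prefix_root {u : RootedPath w} (h : Prefix u (root w)) : u = root w := by
  obtain ⟨x, p⟩ := u
  obtain ⟨q, hq⟩ := h
  cases q with
  | nil => exact congrArg _ hq
  | cons q a => exact nomatch a

theorem prefix_snoc_self (u : RootedPath w) {y : FramedVertex w} (a : FramedArrow w u.target y) :
    Prefix u (u.snoc a) :=
  ⟨Quiver.Path.nil.cons a, rfl⟩

theorem prefix_snoc {u v : RootedPath w} {y : FramedVertex w} {a : FramedArrow w u.target y}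
    (h : Prefix v (u.snoc a)) : v = u.snoc a ∨ Prefix v u := by
  obtain ⟨z, p⟩ := v
  obtain ⟨x, r⟩ := u
  obtain ⟨q, hq⟩ := h
  cases q with
  | nil => exact .inl (congrArg (RootedPath.mk y) hq)
  | cons q b =>
    obtain ⟨rfl, h1, h2⟩ := Quiver.Path.cons.inj hq
    exact .inr ⟨q, eq_of_heq h1⟩

theorem root_prefix (u : RootedPath w) : Prefix (root w) u :=
  ⟨u.path, Quiver.Path.nil_comp _⟩

theorem eq_root_or_snoc (u : RootedPath w) :
    u = root w ∨ ∃ (v : RootedPath w) (y : FramedVertex w) (a : FramedArrow w v.target y),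
      u = v.snoc a := by
  obtain ⟨x, p⟩ := u
  cases p with
  | nil => exact .inl rfl
  | cons q a => exact .inr ⟨⟨_, q⟩, _, a, rfl⟩

theorem snoc_ne_self (u : RootedPath w) {y : FramedVertex w} (a : FramedArrow w u.target y) :
    u ≠ u.snoc a := by
  intro h
  have := congrArg (fun v : RootedPath w => v.path.length) h
  simp [snoc] at this

theorem eq_root_of_target {u : RootedPath w} (h : u.target = .infty) : u = root w := by
  obtain rfl | ⟨v, y, a, rfl⟩ := u.eq_root_or_snoc
  · rfl
  · obtain rfl : y = .infty := h
    exact (isEmpty_framedArrow_infty _).elim a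

theorem IsSubtree.root_mem {S : Finset (RootedPath w)} (hS : IsSubtree S) : root w ∈ S := by
  obtain ⟨⟨v, hv⟩, h⟩ := hS
  exact h v hv _ (root_prefix v)

theorem isSubtree_singleton_root : IsSubtree {root w} :=
  ⟨⟨_, Finset.mem_singleton_self _⟩, fun v hv u huv => by
    rw [Finset.mem_singleton] at hv ⊢
    exact prefix_root (hv ▸ huv)⟩

theorem IsSubtree.insert [DecidableEq (RootedPath w)] {S : Finset (RootedPath w)}
    (hS : IsSubtree S) {v : RootedPath w} (hv : v ∈ criticalSet S) : IsSubtree (insert v S) := by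
  refine ⟨Finset.insert_nonempty _ _, fun x hx u hux => ?_⟩
  rw [Finset.mem_insert] at hx ⊢
  obtain rfl | hx := hx
  · by_cases h : u = x
    · exact .inl h
    · exact .inr (hv.2 u hux h)
  · exact .inr (hS.2 x hx u hux)

/-- A proper prefix of `u.snoc a` is a prefix of `u`, hence in `S`. Arrows therefore leave a tree
only through critical paths. -/
theorem IsSubtree.snoc_mem {S : Finset (RootedPath w)} (hS : IsSubtree S) {u : RootedPath w}
    (hu : u ∈ S) {y : FramedVertex w} (a : FramedArrow w u.target y) :
    u.snoc a ∈ S ∨ u.snoc a ∈ criticalSet S := by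
  by_cases h : u.snoc a ∈ S
  · exact .inl h
  · refine .inr ⟨h, fun x hx hne => hS.2 u hu x ((prefix_snoc hx).resolve_left hne)⟩

theorem exists_snoc_of_mem_criticalSet {S : Finset (RootedPath w)} (hS : IsSubtree S)
    {v : RootedPath w} (hv : v ∈ criticalSet S) :
    ∃ u ∈ S, ∃ (y : FramedVertex w) (a : FramedArrow w u.target y), v = u.snoc a := by
  obtain rfl | ⟨u, y, a, rfl⟩ := v.eq_root_or_snoc
  · exact absurd hS.root_mem hv.1
  · exact ⟨u, hv.2 u (prefix_snoc_self u a) (snoc_ne_self u a), y, a, rfl⟩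

/-! ### Finiteness -/

/-- The prefixes of `u` lie in `S` and realise every length from 0 to that of `u`. -/
theorem length_lt_card {S : Finset (RootedPath w)} (hS : IsSubtree S) {u : RootedPath w}
    (hu : u ∈ S) : u.path.length < S.card := by
  classical
  have key : ∀ n, ∀ v : RootedPath w, v.path.length = n → v ∈ S →
      Finset.range (n + 1) ⊆ S.image fun v => v.path.length := by
    intro n
    induction n with
    | zero =>
      intro v hv hvS k hk
      obtain rfl : k = 0 := by simpa using hk
      exact Finset.mem_image.2 ⟨v, hvS, hv⟩
    | succ n ih =>
      intro v hv hvS k hk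
      obtain rfl | hk := Nat.lt_succ_iff_lt_or_eq.1 (Finset.mem_range.1 hk) |>.symm
      · exact Finset.mem_image.2 ⟨v, hvS, hv⟩
      · obtain rfl | ⟨x, y, a, rfl⟩ := v.eq_root_or_snoc
        · simp [root] at hv
        · exact ih x (by simpa [snoc] using hv) (hS.2 _ hvS x (prefix_snoc_self x a))
            (Finset.mem_range.2 hk)
  have := Finset.card_le_card (key _ u rfl hu)
  rw [Finset.card_range] at this
  exact this.trans Finset.card_image_le

instance instFiniteFramedVertex [Finite I] : Finite (FramedVertex w) :=
  Finite.of_surjective (fun o : Option I => o.elim .infty .base) fun x => match x with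
    | .infty => ⟨none, rfl⟩
    | .base i => ⟨some i, rfl⟩

instance instFiniteFramedArrow [∀ i j : I, Finite (i ⟶ j)] (x y : FramedVertex w) :
    Finite (FramedArrow w x y) := by
  cases x with
  | infty =>
    cases y with
    | infty => exact @Finite.of_subsingleton _ ⟨fun a => nomatch a⟩
    | base i =>
      exact Finite.of_surjective (fun k : Fin (w i) => FramedArrow.frame i k) fun a => by
        cases a with | frame _ k => exact ⟨k, rfl⟩
  | base i =>
    cases y with
    | infty => exact @Finite.of_subsingleton _ ⟨fun a => nomatch a⟩
    | base j =>
      exact Finite.of_surjective (fun a : i ⟶ j => FramedArrow.arrow a) fun a => by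
        cases a with | arrow a => exact ⟨a, rfl⟩

theorem finite_length_le [Finite I] [∀ i j : I, Finite (i ⟶ j)] (n : ℕ) :
    {u : RootedPath w | u.path.length ≤ n}.Finite := by
  induction n with
  | zero =>
    refine (Set.finite_singleton (root w)).subset fun u hu => ?_
    obtain rfl | ⟨v, y, a, rfl⟩ := u.eq_root_or_snoc
    · rfl
    · simp [snoc] at hu
  | succ n ih =>
    have := ih.to_subtype
    refine ((Set.finite_singleton (root w)).union (Set.finite_range
      fun z : Σ (u : {u : RootedPath w | u.path.length ≤ n}) (y : FramedVertex w),
        FramedArrow w u.1.target y => z.1.1.snoc z.2.2)).subset fun u hu => ?_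
    obtain rfl | ⟨v, y, a, rfl⟩ := u.eq_root_or_snoc
    · exact .inl rfl
    · exact .inr ⟨⟨⟨v, by simpa [snoc] using hu⟩, y, a⟩, rfl⟩

theorem card_filter_infty [DecidableEq (FramedVertex w)] {S : Finset (RootedPath w)}
    (hS : IsSubtree S) : (S.filter fun u => u.target = .infty).card = 1 := by
  rw [Finset.card_eq_one]
  refine ⟨root w, Finset.ext fun u => ?_⟩
  rw [Finset.mem_filter, Finset.mem_singleton]
  exact ⟨fun h => eq_root_of_target h.2, fun h => h ▸ ⟨hS.root_mem, rfl⟩⟩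

theorem card_filter_eq [DecidableEq (FramedVertex w)] {d : I → ℕ} {S : Finset (RootedPath w)}
    (hS : S ∈ treesOfDim d) (x : FramedVertex w) :
    (S.filter fun u => u.target = x).card = FramedRep.dimAt d x := by
  cases x with
  | infty => exact card_filter_infty hS.1
  | base i =>
    refine Eq.trans ?_ (hS.2 i)
    rw [← Set.ncard_coe_finset]
    congr 1
    ext u
    simp

theorem card_eq_sum [DecidableEq (FramedVertex w)] [Fintype (FramedVertex w)]
    {d : I → ℕ} {S : Finset (RootedPath w)}
    (hS : S ∈ treesOfDim d) : S.card = ∑ x : FramedVertex w, FramedRep.dimAt d x := by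
  rw [Finset.card_eq_sum_card_fiberwise (f := RootedPath.target) (t := Finset.univ)
    fun _ _ => Finset.mem_coe.2 (Finset.mem_univ _)]
  exact Finset.sum_congr rfl fun x _ => card_filter_eq hS x

theorem card_eq_card [Finite I] {d : I → ℕ} {S S' : Finset (RootedPath w)}
    (hS : S ∈ treesOfDim d) (hS' : S' ∈ treesOfDim d) : S.card = S'.card := by
  classical
  have := Fintype.ofFinite (FramedVertex w)
  rw [card_eq_sum hS, card_eq_sum hS']

theorem finite_treesOfDim [Finite I] [∀ i j : I, Finite (i ⟶ j)] (d : I → ℕ) :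
    (treesOfDim (w := w) d).Finite := by
  classical
  have := Fintype.ofFinite (FramedVertex w)
  set n := ∑ x : FramedVertex w, FramedRep.dimAt d x
  refine ((finite_length_le (w := w) n).toFinset.powerset.finite_toSet).subset fun S hS => ?_
  rw [Finset.mem_coe, Finset.mem_powerset]
  intro u hu
  rw [Set.Finite.mem_toFinset]
  exact ((length_lt_card hS.1 hu).trans_eq (card_eq_sum hS)).le

/-! ### The order on trees -/

variable [LinearOrder (RootedPath w)]

/-- The two orders disagree only if one sorted list is a proper initial segment of the other, as
`TreeLT` demands an entry on both sides. Equal cardinality, which `card_eq_card` gives on P(d),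
excludes this. -/
theorem treeLT_iff_sort_lt {S' S : Finset (RootedPath w)} (h : S'.card = S.card) :
    TreeLT S' S ↔ S'.sort < S.sort := by
  have hl : S'.sort.length = S.sort.length := by simpa using h
  rw [List.lt_iff_exists]
  constructor
  · rintro ⟨i, hj, a, b, ha, hb, hab⟩
    obtain ⟨hi', rfl⟩ := List.getElem?_eq_some_iff.1 ha
    obtain ⟨hi, rfl⟩ := List.getElem?_eq_some_iff.1 hb
    refine .inr ⟨i, hi', hi, fun j hji => ?_, hab⟩
    have := hj j hji
    rw [List.getElem?_eq_getElem (hji.trans hi'), List.getElem?_eq_getElem (hji.trans hi)] at this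
    exact Option.some.inj this
  · rintro (⟨-, h⟩ | ⟨i, hi', hi, hj, hab⟩)
    · exact absurd hl h.ne
    · refine ⟨i, fun j hji => ?_, _, _, List.getElem?_eq_getElem hi', List.getElem?_eq_getElem hi,
        hab⟩
      rw [List.getElem?_eq_getElem (hji.trans hi'), List.getElem?_eq_getElem (hji.trans hi),
        hj j hji]

/-- If `S' < S`, then at the first difference `S'` has an element that `S` lacks. -/
theorem TreeLT.exists_mem {S' S : Finset (RootedPath w)} (h : TreeLT S' S) :
    ∃ a ∈ S', a ∉ S ∧ ∀ u < a, (u ∈ S' ↔ u ∈ S) := by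
  obtain ⟨i, hj, a, b, ha, hb, hab⟩ := h
  obtain ⟨hi', rfl⟩ := List.getElem?_eq_some_iff.1 ha
  obtain ⟨hi, rfl⟩ := List.getElem?_eq_some_iff.1 hb
  have hm' := (Finset.sortedLT_sort S').strictMono_get
  have hm := (Finset.sortedLT_sort S).strictMono_get
  have hj' : ∀ j (hji : j < i), S'.sort[j] = S.sort[j] := fun j hji => by
    have := hj j hji
    rw [List.getElem?_eq_getElem (hji.trans hi'), List.getElem?_eq_getElem (hji.trans hi)] at this
    exact Option.some.inj this
  refine ⟨_, (Finset.mem_sort (· ≤ ·)).1 (List.getElem_mem hi'), fun hmem => ?_, fun u hu =>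
    ⟨fun hmem => ?_, fun hmem => ?_⟩⟩
  -- Suppose `S'.sort[i]` were entry `j` of `S`. For `j < i` it would repeat an entry of `S'`; for
  -- `j ≥ i` it would be at least `S.sort[i]`, which is larger.
  · obtain ⟨j, hjl, hje⟩ := List.getElem_of_mem ((Finset.mem_sort (· ≤ ·)).2 hmem)
    rcases lt_or_ge j i with hji | hij
    · have h1 : S'.sort[j] < S'.sort[i] := hm' (a := ⟨j, hji.trans hi'⟩) (b := ⟨i, hi'⟩) hji
      rw [hj' j hji, hje] at h1
      exact h1.false
    · have h1 : S.sort[i] ≤ S.sort[j] := hm.monotone (a := ⟨i, hi⟩) (b := ⟨j, hjl⟩) hij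
      rw [hje] at h1
      exact (hab.trans_le h1).false
  · obtain ⟨j, hjl, rfl⟩ := List.getElem_of_mem ((Finset.mem_sort (· ≤ ·)).2 hmem)
    have hji : j < i := hm'.lt_iff_lt (a := ⟨j, hjl⟩) (b := ⟨i, hi'⟩) |>.1 hu
    rw [hj' j hji]
    exact (Finset.mem_sort (· ≤ ·)).1 (List.getElem_mem _)
  · obtain ⟨j, hjl, rfl⟩ := List.getElem_of_mem ((Finset.mem_sort (· ≤ ·)).2 hmem)
    have hji : j < i := hm.lt_iff_lt (a := ⟨j, hjl⟩) (b := ⟨i, hi⟩) |>.1 (hu.trans hab)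
    rw [← hj' j hji]
    exact (Finset.mem_sort (· ≤ ·)).1 (List.getElem_mem _)

/-- The set `P(d)`, to be ordered by `TreeLT`. -/
def OrderedTree (w d : I → ℕ) : Type (max u v) := {S // S ∈ treesOfDim (w := w) d}

/-- The total order on `P(d)`. -/
noncomputable instance OrderedTree.instLinearOrder (d : I → ℕ) : LinearOrder (OrderedTree w d) :=
  LinearOrder.lift' (fun S => S.1.sort) fun S S' h => by
    classical
    refine Subtype.ext ?_
    rw [← Finset.sort_toFinset (r := (· ≤ ·)) (s := S.1),
      ← Finset.sort_toFinset (r := (· ≤ ·)) (s := S'.1)]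
    exact congrArg List.toFinset h

theorem OrderedTree.lt_iff [Finite I] {d : I → ℕ} {S' S : OrderedTree w d} :
    S' < S ↔ TreeLT S'.1 S.1 :=
  (treeLT_iff_sort_lt (card_eq_card S'.2 S.2)).symm

theorem OrderedTree.le_iff [Finite I] {d : I → ℕ} {S' S : OrderedTree w d} :
    S' ≤ S ↔ TreeLE S'.1 S.1 := by
  rw [le_iff_eq_or_lt, TreeLE, lt_iff]
  exact or_congr_left Subtype.ext_iff

theorem OrderedTree.treeLE_trans [Finite I] {d : I → ℕ} (S T U : OrderedTree w d)
    (hST : TreeLE S.1 T.1) (hTU : TreeLE T.1 U.1) : TreeLE S.1 U.1 :=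
  le_iff.1 ((le_iff.2 hST).trans (le_iff.2 hTU))

end RootedPath

/-! ## Bases of a representation indexed by trees -/

namespace FramedRep

theorem finrank_total {I : Type u} {w d : I → ℕ} [Fintype (FramedVertex w)] :
    Module.finrank ℂ ((x : FramedVertex w) → Space w d x) = ∑ x : FramedVertex w, dimAt d x := by
  rw [Module.finrank_pi_fintype]
  simp

open RootedPath

variable {I : Type u} [Quiver.{v} I] {w d : I → ℕ}

/-- The vectors `m_u`, `u ∈ S`, form a basis of `M`. -/
def IsTreeBasis (M : FramedRep w d) (S : Finset (RootedPath w)) : Prop :=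
  LinearIndependent ℂ (fun u : S => M.vec u.1) ∧
    Submodule.span ℂ (M.vec '' (S : Set (RootedPath w))) = ⊤

/-! ### Path vectors in the total space -/

open Classical in
theorem vec_def (M : FramedRep w d) (u : RootedPath w) :
    M.vec u = Pi.single u.target (M.pathVector u.path) := rfl

theorem vec_target (M : FramedRep w d) (u : RootedPath w) :
    M.vec u u.target = M.pathVector u.path := by
  classical
  rw [vec_def, Pi.single_eq_same]

theorem vec_of_ne (M : FramedRep w d) {u : RootedPath w} {x : FramedVertex w} (h : x ≠ u.target) :
    M.vec u x = 0 := by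
  classical
  rw [vec_def, Pi.single_eq_of_ne h]

open Classical in
/-- An arrow, acting on the total space of the representation. -/
noncomputable def totalAct (M : FramedRep w d) {x y : FramedVertex w} (a : FramedArrow w x y) :
    ((x : FramedVertex w) → Space w d x) →ₗ[ℂ] ((x : FramedVertex w) → Space w d x) :=
  LinearMap.single ℂ (Space w d) y ∘ₗ M.act a ∘ₗ LinearMap.proj x

theorem totalAct_vec (M : FramedRep w d) (u : RootedPath w) {y : FramedVertex w}
    (a : FramedArrow w u.target y) : M.totalAct a (M.vec u) = M.vec (u.snoc a) := by
  classical
  simp only [totalAct, LinearMap.comp_apply, LinearMap.proj_apply, vec_target]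
  rfl

theorem totalAct_vec_of_ne (M : FramedRep w d) {u : RootedPath w} {x y : FramedVertex w}
    (a : FramedArrow w x y) (h : x ≠ u.target) : M.totalAct a (M.vec u) = 0 := by
  simp [totalAct, LinearMap.comp_apply, LinearMap.proj_apply, vec_of_ne M h]

theorem pathVector_mem (M : FramedRep w d) (L : (x : FramedVertex w) → Submodule ℂ (Space w d x))
    (hL : ∀ (x y : FramedVertex w) (a : FramedArrow w x y), (L x).map (M.act a) ≤ L y)
    (h : L .infty = ⊤) {x : FramedVertex w}
    (p : Quiver.Path (FramedVertex.infty : FramedVertex w) x) : M.pathVector p ∈ L x := by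
  induction p with
  | nil => rw [h]; trivial
  | cons p a ih => exact hL _ _ a (Submodule.mem_map_of_mem ih)

/-- A subrepresentation containing M_∞ contains all path vectors. This makes stability automatic for
representations built from a tree. -/
theorem isStable_of_span_eq_top (M : FramedRep w d) {S : Set (RootedPath w)}
    (hS : Submodule.span ℂ (M.vec '' S) = ⊤) : M.IsStable := by
  classical
  intro L hL h x
  have hle : Submodule.span ℂ (M.vec '' S) ≤ Submodule.pi Set.univ L := by
    rw [Submodule.span_le]
    rintro _ ⟨u, -, rfl⟩ y -
    by_cases hy : y = u.target
    · subst hy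
      change M.vec u u.target ∈ L u.target
      rw [vec_target]
      exact M.pathVector_mem L hL h u.path
    · change M.vec u y ∈ L y
      rw [vec_of_ne M hy]
      exact zero_mem _
  rw [hS] at hle
  refine eq_top_iff.2 fun m _ => ?_
  have := hle (show Pi.single x m ∈ ⊤ from trivial) x trivial
  rwa [Pi.single_eq_same] at this

theorem pathVector_nil_smul (M : FramedRep w d) (m : Space w d FramedVertex.infty) :
    m = m (0 : Fin 1) • M.pathVector (.nil : Quiver.Path (FramedVertex.infty : FramedVertex w) _) := by
  funext k
  obtain rfl : k = (0 : Fin 1) := Subsingleton.elim (α := Fin 1) _ _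
  exact (mul_one _).symm

/-- If all critical vectors lay in the span `W`, each arrow would send m_u, u ∈ T, to zero or to the
vector of a path that is in `T` or critical, hence into `W`. The vertex components of `W` would form
a subrepresentation containing M_∞, and stability would make `W` everything. -/
theorem exists_criticalSet_notMem_span [Finite I] {M : FramedRep w d} (hM : M.IsStable)
    {T : Finset (RootedPath w)} (hT : IsSubtree T)
    (hspan : Submodule.span ℂ (M.vec '' (T : Set (RootedPath w))) ≠ ⊤) :
    ∃ v ∈ criticalSet T, M.vec v ∉ Submodule.span ℂ (M.vec '' (T : Set (RootedPath w))) := by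
  classical
  by_contra! hcon
  set W := Submodule.span ℂ (M.vec '' (T : Set (RootedPath w)))
  have hact : ∀ {x y : FramedVertex w} (a : FramedArrow w x y), W ≤ W.comap (M.totalAct a) := by
    intro x y a
    rw [Submodule.span_le]
    rintro _ ⟨u, hu, rfl⟩
    rw [SetLike.mem_coe, Submodule.mem_comap]
    by_cases hx : x = u.target
    · subst hx
      rw [totalAct_vec]
      obtain h | h := hT.snoc_mem hu a
      · exact Submodule.subset_span ⟨_, h, rfl⟩
      · exact hcon _ h
    · rw [totalAct_vec_of_ne M a hx]
      exact zero_mem _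
  have hL := hM (fun x => W.comap (LinearMap.single ℂ (Space w d) x)) ?_ ?_
  · refine hspan (eq_top_iff.2 fun m _ => ?_)
    have := Fintype.ofFinite (FramedVertex w)
    rw [← Finset.univ_sum_single m]
    refine sum_mem fun x _ => ?_
    have : m x ∈ W.comap (LinearMap.single ℂ (Space w d) x) := by rw [hL x]; trivial
    exact this
  · rintro x y a _ ⟨m, hm, rfl⟩
    have := hact a hm
    simpa [totalAct] using this
  · refine eq_top_iff.2 fun m _ => ?_
    have hroot : M.vec (root w) ∈ W := Submodule.subset_span ⟨_, hT.root_mem, rfl⟩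
    rw [M.pathVector_nil_smul m]
    exact Submodule.smul_mem _ _ hroot

theorem linearIndependent_insert_vec (M : FramedRep w d) [DecidableEq (RootedPath w)]
    {T : Finset (RootedPath w)}
    (hT : LinearIndependent ℂ (fun u : T => M.vec u.1)) {v : RootedPath w}
    (hv : M.vec v ∉ Submodule.span ℂ (M.vec '' (T : Set (RootedPath w)))) :
    LinearIndependent ℂ (fun u : (insert v T : Finset (RootedPath w)) => M.vec u.1) := by
  have := LinearIndepOn.insert (s := (T : Set (RootedPath w))) (v := M.vec) hT hv
  rw [← Finset.coe_insert] at this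
  exact this

theorem linearIndependent_vec_mono (M : FramedRep w d) {S T : Finset (RootedPath w)} (h : T ⊆ S)
    (hS : LinearIndependent ℂ (fun u : S => M.vec u.1)) :
    LinearIndependent ℂ (fun u : T => M.vec u.1) :=
  LinearIndepOn.mono (s := (S : Set (RootedPath w))) (t := (T : Set (RootedPath w))) hS h

theorem single_vec (M : FramedRep w d) [DecidableEq (FramedVertex w)] {u : RootedPath w} {x : FramedVertex w}
    (h : u.target = x) : LinearMap.single ℂ (Space w d) x (M.vec u x) = M.vec u := by
  funext y
  obtain rfl | hy := eq_or_ne y x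
  · simp
  · rw [LinearMap.single_apply, Pi.single_eq_of_ne hy, vec_of_ne M (h ▸ hy)]

theorem card_fiber_le (M : FramedRep w d) [DecidableEq (FramedVertex w)]
    {S : Finset (RootedPath w)}
    (hS : LinearIndependent ℂ (fun u : S => M.vec u.1)) (x : FramedVertex w) :
    (S.filter fun u => u.target = x).card ≤ dimAt d x := by
  classical
  have h1 := M.linearIndependent_vec_mono (Finset.filter_subset (fun u => u.target = x) S) hS
  have h2 : LinearIndependent ℂ (fun u : (S.filter fun u => u.target = x) => M.vec u.1 x) := by
    have h3 : (LinearMap.single ℂ (Space w d) x) ∘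
        (fun u : (S.filter fun u => u.target = x) => M.vec u.1 x) = fun u => M.vec u.1 :=
      funext fun u => M.single_vec (Finset.mem_filter.1 u.2).2
    rw [← h3] at h1
    exact LinearIndependent.of_comp _ h1
  have := h2.fintype_card_le_finrank
  rwa [Fintype.card_coe, Module.finrank_fin_fun] at this

/-- A tree that indexes a basis of a representation of dimension vector `d` lies in `P(d)`. -/
theorem IsTreeBasis.mem_treesOfDim [Finite I] {M : FramedRep w d} {S : Finset (RootedPath w)}
    (hS : M.IsTreeBasis S) (hT : IsSubtree S) : S ∈ treesOfDim d := by
  classical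
  have := Fintype.ofFinite (FramedVertex w)
  have hcard : S.card = ∑ x : FramedVertex w, dimAt d x := by
    rw [← finrank_total (w := w) (d := d)]
    have hb := Module.Basis.mk hS.1 (by
      rw [← hS.2, Set.image_eq_range]
      exact le_rfl)
    rw [Module.finrank_eq_card_basis hb, Fintype.card_coe]
  rw [Finset.card_eq_sum_card_fiberwise (f := RootedPath.target) (t := Finset.univ)
    fun _ _ => Finset.mem_coe.2 (Finset.mem_univ _)] at hcard
  -- The upper bounds at the vertices have the same total as the fibre sizes, so each of them is
  -- attained.
  have := (Finset.sum_eq_sum_iff_of_le fun x _ => M.card_fiber_le hS.1 x).1 hcard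
  refine ⟨hT, fun i => ?_⟩
  refine Eq.trans ?_ (this (.base i) (Finset.mem_univ _))
  rw [← Set.ncard_coe_finset]
  congr 1
  ext u
  simp

theorem isTreeBasis_iff_span [Finite I] (M : FramedRep w d) {S : Finset (RootedPath w)}
    (hS : S ∈ treesOfDim d) :
    M.IsTreeBasis S ↔ Submodule.span ℂ (M.vec '' (S : Set (RootedPath w))) = ⊤ := by
  classical
  have := Fintype.ofFinite (FramedVertex w)
  refine ⟨fun h => h.2, fun h => ⟨?_, h⟩⟩
  refine linearIndependent_of_top_le_span_of_card_eq_finrank ?_ ?_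
  · rw [← h, Set.image_eq_range]
    exact le_rfl
  · rw [Fintype.card_coe, finrank_total, card_eq_sum hS]

/-- A tree with linearly independent vectors extends to a tree that indexes a basis. -/
theorem exists_isTreeBasis [Finite I] {M : FramedRep w d} (hM : M.IsStable)
    {T : Finset (RootedPath w)} (hT : IsSubtree T)
    (hli : LinearIndependent ℂ (fun u : T => M.vec u.1)) :
    ∃ S ∈ treesOfDim d, T ⊆ S ∧ M.IsTreeBasis S := by
  classical
  have := Fintype.ofFinite (FramedVertex w)
  -- Induction on a bound `n` for the number of missing vectors; at `n = 0` one more independent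
  -- vector would exceed the dimension.
  have key : ∀ n, ∀ T : Finset (RootedPath w), IsSubtree T →
      LinearIndependent ℂ (fun u : T => M.vec u.1) →
      ∑ x : FramedVertex w, dimAt d x ≤ T.card + n → ∃ S ∈ treesOfDim d, T ⊆ S ∧
        M.IsTreeBasis S := by
    intro n
    induction n with
    | zero =>
      intro T hT hli hn
      by_cases htop : Submodule.span ℂ (M.vec '' (T : Set (RootedPath w))) = ⊤
      · exact ⟨T, IsTreeBasis.mem_treesOfDim ⟨hli, htop⟩ hT, subset_rfl, hli, htop⟩
      · obtain ⟨v, hv, hvs⟩ := exists_criticalSet_notMem_span hM hT htop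
        have h1 := (linearIndependent_insert_vec M hli hvs).fintype_card_le_finrank
        rw [finrank_total, Fintype.card_coe, Finset.card_insert_of_notMem hv.1] at h1
        omega
    | succ n ih =>
      intro T hT hli hn
      by_cases htop : Submodule.span ℂ (M.vec '' (T : Set (RootedPath w))) = ⊤
      · exact ⟨T, IsTreeBasis.mem_treesOfDim ⟨hli, htop⟩ hT, subset_rfl, hli, htop⟩
      · obtain ⟨v, hv, hvs⟩ := exists_criticalSet_notMem_span hM hT htop
        obtain ⟨S, hS, hTS, hb⟩ := ih _ (hT.insert hv) (linearIndependent_insert_vec M hli hvs) (by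
          rw [Finset.card_insert_of_notMem hv.1]
          omega)
        exact ⟨S, hS, (Finset.subset_insert _ _).trans hTS, hb⟩
  exact key _ T hT hli (Nat.le_add_left _ _)

theorem exists_isTreeBasis_of_isStable [Finite I] {M : FramedRep w d} (hM : M.IsStable) :
    ∃ S ∈ treesOfDim d, M.IsTreeBasis S := by
  classical
  obtain ⟨S, hS, -, h⟩ := exists_isTreeBasis hM isSubtree_singleton_root <| by
    refine LinearIndependent.of_subsingleton (⟨root w, by simp⟩ : ({root w} : Finset _)) fun h => ?_
    have := congrFun (congrFun h (root w).target) (0 : Fin 1)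
    rw [vec_target] at this
    exact one_ne_zero this
  exact ⟨S, hS, h⟩

/-! ### Comparison of the trees that index bases -/

variable [LinearOrder (RootedPath w)]

/-- The condition defining `Z_S`: every `m_v` with `v` critical is a combination of the preceding
basis vectors. -/
def IsCellular (M : FramedRep w d) (S : Finset (RootedPath w)) : Prop :=
  ∀ v ∈ criticalSet S, M.vec v ∈ Submodule.span ℂ (M.vec '' {u | u ∈ S ∧ u < v})

/-- Take the first element `a` of `S'` missing from `S`. Its proper prefixes precede it by
admissibility, so they lie in `S` as well and `a` is critical for `S`. The cell condition expresses
m_a through elements of `S` below `a`, which also belong to `S'`. -/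
theorem IsCellular.not_treeLT (hadm : Admissible w) {M : FramedRep w d}
    {S S' : Finset (RootedPath w)} (hc : M.IsCellular S) (hS' : IsSubtree S')
    (hb : LinearIndependent ℂ (fun u : S' => M.vec u.1)) : ¬ TreeLT S' S := by
  intro hlt
  obtain ⟨a, ha', ha, h⟩ := hlt.exists_mem
  have hcrit : a ∈ criticalSet S := ⟨ha, fun u hu hne =>
    (h u (lt_of_le_of_ne (hadm u a hu) hne)).1 (hS'.2 a ha' u hu)⟩
  refine LinearIndependent.notMem_span_image hb (s := {u | u.1 < a}) (x := ⟨a, ha'⟩)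
    (fun h => lt_irrefl a h) ?_
  refine Submodule.span_mono ?_ (hc a hcrit)
  rintro _ ⟨u, ⟨hu, hua⟩, rfl⟩
  exact ⟨⟨u, (h u hua).2 hu⟩, hua, rfl⟩

/-- If `M` does not satisfy the condition of `Z_S`, then a smaller tree indexes a basis as well. -/
theorem IsTreeBasis.exists_treeLT [Finite I] (hadm : Admissible w) {M : FramedRep w d}
    (hM : M.IsStable) {S : Finset (RootedPath w)} (hS : S ∈ treesOfDim d) (hb : M.IsTreeBasis S)
    (hc : ¬ M.IsCellular S) : ∃ S' ∈ treesOfDim d, M.IsTreeBasis S' ∧ TreeLT S' S := by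
  classical
  simp only [IsCellular, not_forall] at hc
  obtain ⟨v, hv, hvs⟩ := hc
  -- Cut `S` off below `v`: admissibility keeps this a tree and keeps `v` critical for it, and the
  -- failing cell condition says that m_v is independent of it.
  set T := S.filter (· < v)
  have hTs : (T : Set (RootedPath w)) = {u | u ∈ S ∧ u < v} := by
    ext u
    simp [T]
  have hvroot : root w < v := lt_of_le_of_ne (hadm _ _ (root_prefix v)) fun h =>
    hv.1 (h ▸ hS.1.root_mem)
  have hT : IsSubtree T := by
    refine ⟨⟨root w, Finset.mem_filter.2 ⟨hS.1.root_mem, hvroot⟩⟩, fun x hx u hu => ?_⟩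
    rw [Finset.mem_filter] at hx ⊢
    exact ⟨hS.1.2 x hx.1 u hu, (hadm u x hu).trans_lt hx.2⟩
  have hTli := M.linearIndependent_vec_mono (Finset.filter_subset (· < v) S) hb.1
  have hvT : v ∈ criticalSet T := ⟨fun h => hv.1 (Finset.mem_filter.1 h).1, fun u hu hne =>
    Finset.mem_filter.2 ⟨hv.2 u hu hne, lt_of_le_of_ne (hadm u v hu) hne⟩⟩
  obtain ⟨S', hS', hTS', hb'⟩ := exists_isTreeBasis hM (hT.insert hvT)
    (linearIndependent_insert_vec M hTli (by rwa [hTs]))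
  have hvS' : v ∈ S' := hTS' (Finset.mem_insert_self _ _)
  refine ⟨S', hS', hb', ?_⟩
  -- `S'` contains `v` and all of `S` below `v`, while `v ∉ S`. If `S < S'`, the first element of
  -- `S` missing from `S'` cannot be `v` or lie below it; above `v`, agreement of the two trees at
  -- `v` would put `v` in `S`.
  rcases lt_trichotomy (α := OrderedTree w d) ⟨S, hS⟩ ⟨S', hS'⟩ with h | h | h
  · obtain ⟨a, haS, haS', h⟩ := (OrderedTree.lt_iff.1 h).exists_mem
    rcases lt_trichotomy a v with hav | rfl | hva
    · exact absurd (hTS' (Finset.mem_insert_of_mem (Finset.mem_filter.2 ⟨haS, hav⟩))) haS'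
    · exact absurd haS hv.1
    · exact absurd ((h v hva).2 hvS') hv.1
  · have h' : S = S' := congrArg Subtype.val h
    exact absurd (h' ▸ hvS') hv.1
  · exact OrderedTree.lt_iff.1 h

end FramedRep

/-! ## Charts of the noncommutative Hilbert scheme -/

namespace FramedRep

open RootedPath

variable {I : Type u} [Quiver.{v} I] {w d : I → ℕ}

/-! ### Equivariance under change of bases -/

/-- The action of an element of the gauge group on the space at the vertex `x`. -/
noncomputable def gaugeAt (g : GaugeGroup d) : (x : FramedVertex w) → Space w d x →ₗ[ℂ] Space w d x
  | .infty => LinearMap.id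
  | .base i => (g i).val.mulVecLin

theorem act_gauge (g : GaugeGroup d) (M : FramedRep w d) {x y : FramedVertex w}
    (a : FramedArrow w x y) (m : Space w d x) :
    (g • M).act a (gaugeAt g x m) = gaugeAt g y (M.act a m) := by
  cases a with
  | frame i k =>
    have h : ∀ c : ℂ, (fun l => c * ((g i).val * M.frameMatrix i) l k)
        = (g i).val.mulVec fun l => c * M.frameMatrix i l k := fun c => by
      funext l
      simp only [Matrix.mul_apply, Matrix.mulVec, dotProduct, Finset.mul_sum]
      exact Finset.sum_congr rfl fun _ _ => mul_left_comm _ _ _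
    exact h (m (0 : Fin 1))
  | @arrow i j a =>
    have h : ∀ m : Fin (d i) → ℂ,
        ((g j).val * M.arrowMatrix a * ((g i)⁻¹).val).mulVec ((g i).val.mulVec m)
          = (g j).val.mulVec ((M.arrowMatrix a).mulVec m) := fun m => by
      rw [Matrix.mulVec_mulVec, Matrix.mulVec_mulVec, Matrix.mul_assoc, ← Units.val_mul,
        inv_mul_cancel, Units.val_one, Matrix.mul_one]
    exact h m

theorem pathVector_gauge (g : GaugeGroup d) (M : FramedRep w d) {x : FramedVertex w}
    (p : Quiver.Path (FramedVertex.infty : FramedVertex w) x) :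
    (g • M).pathVector p = gaugeAt g x (M.pathVector p) := by
  induction p with
  | nil => rfl
  | cons p a ih =>
    change (g • M).act a ((g • M).pathVector p) = gaugeAt g _ (M.act a (M.pathVector p))
    rw [ih, act_gauge]

theorem vec_gauge (g : GaugeGroup d) (M : FramedRep w d) (u : RootedPath w) :
    (g • M).vec u = (LinearMap.pi fun x => gaugeAt g x ∘ₗ LinearMap.proj x) (M.vec u) := by
  funext x
  rw [LinearMap.pi_apply, LinearMap.comp_apply, LinearMap.proj_apply]
  by_cases hx : x = u.target
  · subst hx
    rw [vec_target, vec_target, pathVector_gauge]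
  · rw [vec_of_ne _ hx, vec_of_ne _ hx, map_zero]

theorem IsCellular.gauge [LinearOrder (RootedPath w)] {M : FramedRep w d}
    {S : Finset (RootedPath w)} (h : M.IsCellular S) (g : GaugeGroup d) :
    (g • M).IsCellular S := by
  intro v hv
  have h1 : (g • M).vec = (LinearMap.pi fun x => gaugeAt g x ∘ₗ LinearMap.proj x) ∘ M.vec :=
    funext fun u => vec_gauge g M u
  rw [h1, Set.image_comp, Submodule.span_image]
  exact Submodule.mem_map_of_mem (h v hv)

/-- The vector `m_p` of a path `p` that ends at a vertex `i` of the unframed quiver. -/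
noncomputable def baseVector (M : FramedRep w d) {i : I}
    (p : Quiver.Path (FramedVertex.infty : FramedVertex w) (.base i)) : Fin (d i) → ℂ :=
  M.pathVector p

/-- The component at the vertex `i` of a vector of the total space. -/
noncomputable def baseProj (w d : I → ℕ) (i : I) :
    ((x : FramedVertex w) → Space w d x) →ₗ[ℂ] (Fin (d i) → ℂ) :=
  LinearMap.proj (φ := Space w d) (.base i)

open Classical in
/-- The inclusion of the space at the vertex `i` in the total space. -/
noncomputable def baseIncl (w d : I → ℕ) (i : I) :
    (Fin (d i) → ℂ) →ₗ[ℂ] ((x : FramedVertex w) → Space w d x) :=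
  LinearMap.single ℂ (Space w d) (.base i)

theorem baseProj_vec (M : FramedRep w d) {i : I}
    (p : Quiver.Path (FramedVertex.infty : FramedVertex w) (.base i)) :
    baseProj w d i (M.vec ⟨.base i, p⟩) = M.baseVector p :=
  M.vec_target ⟨.base i, p⟩

theorem baseProj_vec_of_ne (M : FramedRep w d) {i : I} {u : RootedPath w}
    (h : .base i ≠ u.target) : baseProj w d i (M.vec u) = 0 :=
  vec_of_ne M h

theorem baseIncl_baseVector (M : FramedRep w d) {i : I}
    (p : Quiver.Path (FramedVertex.infty : FramedVertex w) (.base i)) :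
    baseIncl w d i (M.baseVector p) = M.vec ⟨.base i, p⟩ := rfl

theorem baseVector_gauge (g : GaugeGroup d) (M : FramedRep w d) {i : I}
    (p : Quiver.Path (FramedVertex.infty : FramedVertex w) (.base i)) :
    (g • M).baseVector p = (g i).val.mulVec (M.baseVector p) :=
  pathVector_gauge g M p

theorem baseVector_cons_arrow (M : FramedRep w d) {i j : I}
    (p : Quiver.Path (FramedVertex.infty : FramedVertex w) (.base i)) (a : i ⟶ j) :
    M.baseVector (p.cons (FramedArrow.arrow a)) = (M.arrowMatrix a).mulVec (M.baseVector p) := rfl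

theorem baseVector_cons_frame (M : FramedRep w d) (i : I) (k : Fin (w i)) :
    M.baseVector (Quiver.Path.nil.cons (FramedArrow.frame i k)) = fun l => M.frameMatrix i l k :=
  funext fun l => one_mul (M.frameMatrix i l k)

/-- A path that ends at a vertex of the unframed quiver is an arrow of the framing, or arises from
such a path by appending an arrow. -/
theorem exists_eq_cons {i : I} (p : Quiver.Path (FramedVertex.infty : FramedVertex w) (.base i)) :
    (∃ k, p = Quiver.Path.nil.cons (FramedArrow.frame i k)) ∨
      ∃ (j : I) (q : Quiver.Path (FramedVertex.infty : FramedVertex w) (.base j)) (a : j ⟶ i),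
        p = q.cons (FramedArrow.arrow a) := by
  cases p with
  | @cons x _ q a =>
    change FramedArrow w x _ at a
    cases a with
    | frame _ k =>
      cases q with
      | nil => exact .inl ⟨k, rfl⟩
      | cons q b => exact (isEmpty_framedArrow_infty _).elim b
    | arrow a => exact .inr ⟨_, q, a, rfl⟩

/-- The induction is on a length bound because removing the last arrow changes the end vertex; each
arrow multiplies by a matrix of coordinates. -/
theorem baseVector_mem_polynomialFunctions (n : ℕ) : ∀ {i : I}
    (p : Quiver.Path (FramedVertex.infty : FramedVertex w) (.base i)) (k : Fin (d i)),
    p.length ≤ n → (fun M : FramedRepCoord w d → ℂ => FramedRep.baseVector (d := d) M p k) ∈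
      SpaceWithFunctions.polynomialFunctions (FramedRepCoord w d) := by
  induction n with
  | zero =>
    intro i p k hp
    cases p with
    | cons p a => exact absurd hp (Nat.not_succ_le_zero _)
  | succ n ih =>
    intro i p k hp
    obtain ⟨l, rfl⟩ | ⟨j, q, a, rfl⟩ := exists_eq_cons p
    · have : (fun M : FramedRepCoord w d → ℂ => FramedRep.baseVector (d := d) M
          (Quiver.Path.nil.cons (FramedArrow.frame i l)) k) =
          fun M => M (FramedRepCoord.frame i k l) :=
        funext fun M => congrFun (baseVector_cons_frame (d := d) M i l) k
      rw [this]
      exact SpaceWithFunctions.coord_mem_polynomialFunctions (FramedRepCoord.frame i k l)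
    · have : (fun M : FramedRepCoord w d → ℂ =>
          FramedRep.baseVector (d := d) M (q.cons (FramedArrow.arrow a)) k) =
          ∑ l : Fin (d j), (fun M => M (FramedRepCoord.arrow a k l)) *
            fun M => FramedRep.baseVector (d := d) M q l := by
        funext M
        rw [Finset.sum_apply]
        rfl
      rw [this]
      exact sum_mem fun l _ => mul_mem
        (SpaceWithFunctions.coord_mem_polynomialFunctions (FramedRepCoord.arrow a k l))
        (ih q l (Nat.le_of_succ_le_succ hp))

end FramedRep

namespace RootedPath

variable {I : Type u} [Quiver.{v} I] {w : I → ℕ}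

theorem mk_injective (x : FramedVertex w) : Function.Injective (RootedPath.mk x) :=
  fun _ _ h => eq_of_heq (RootedPath.mk.inj h).2

/-- A numbering, for every vertex `i`, of the elements of the tree `S` with target `i`. -/
structure Labelling (S : Finset (RootedPath w)) (d : I → ℕ) where
  label : (i : I) → Fin (d i) → Quiver.Path (FramedVertex.infty : FramedVertex w) (.base i)
  injective : ∀ i, Function.Injective (label i)
  mem_iff : ∀ (i : I) (p : Quiver.Path (FramedVertex.infty : FramedVertex w) (.base i)),
    RootedPath.mk (.base i) p ∈ S ↔ ∃ l, label i l = p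

theorem nonempty_labelling {S : Finset (RootedPath w)} {d : I → ℕ} (hS : S ∈ treesOfDim d) :
    Nonempty (Labelling S d) := by
  have key : ∀ i, Nonempty (Fin (d i) ≃ {p | RootedPath.mk (.base i) p ∈ S}) := fun i => by
    have himg : {u | u ∈ S ∧ u.target = .base i} =
        RootedPath.mk (.base i) '' {p | RootedPath.mk (.base i) p ∈ S} := by
      ext ⟨x, p⟩
      constructor
      · rintro ⟨h, rfl⟩
        exact ⟨p, h, rfl⟩
      · rintro ⟨q, h, hq⟩
        exact hq ▸ ⟨h, rfl⟩
    have hcard := hS.2 i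
    rw [himg, Set.ncard_image_of_injective _ (mk_injective _)] at hcard
    have hfin : Finite {p | RootedPath.mk (.base i) p ∈ S} :=
      (S.finite_toSet.preimage (mk_injective (.base i)).injOn).to_subtype
    exact ⟨(Finite.equivFinOfCardEq hcard).symm⟩
  let e := fun i => (key i).some
  exact ⟨⟨fun i l => (e i l).1, fun i => Subtype.val_injective.comp (e i).injective, fun i p =>
    ⟨fun h => ⟨(e i).symm ⟨p, h⟩, by simp⟩, fun ⟨l, h⟩ => h ▸ (e i l).2⟩⟩⟩

namespace Labelling

open FramedRep

variable {S : Finset (RootedPath w)} {d : I → ℕ} (B : Labelling S d)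

theorem label_mem (i : I) (l : Fin (d i)) : RootedPath.mk (.base i) (B.label i l) ∈ S :=
  (B.mem_iff i _).2 ⟨l, rfl⟩

/-- The matrix whose columns are the vectors `m_u`, for the `u ∈ S` with target `i`. -/
noncomputable def basisMatrix (M : FramedRep w d) (i : I) : Matrix (Fin (d i)) (Fin (d i)) ℂ :=
  Matrix.of fun k l => M.baseVector (B.label i l) k

theorem basisMatrix_gauge (g : GaugeGroup d) (M : FramedRep w d) (i : I) :
    B.basisMatrix (g • M) i = (g i).val * B.basisMatrix M i := by
  ext k l
  change (g • M).baseVector (B.label i l) k = _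
  rw [baseVector_gauge]
  rfl

theorem basisMatrix_mulVec (M : FramedRep w d) (i : I) (c : Fin (d i) → ℂ) :
    (B.basisMatrix M i).mulVec c = ∑ l, c l • M.baseVector (B.label i l) := by
  funext k
  rw [Finset.sum_apply]
  change ∑ l, M.baseVector (B.label i l) k * c l = ∑ l, c l * M.baseVector (B.label i l) k
  exact Finset.sum_congr rfl fun l _ => mul_comm (M.baseVector (B.label i l) k) (c l)

/-- Projection to the vertex `i` kills the vectors with another target, so spanning can be tested at
each vertex separately. -/
theorem range_basisMatrix (M : FramedRep w d) (i : I) :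
    LinearMap.range (B.basisMatrix M i).mulVecLin =
      (Submodule.span ℂ (M.vec '' (S : Set (RootedPath w)))).map (baseProj w d i) := by
  apply le_antisymm
  · rintro _ ⟨c, rfl⟩
    rw [Matrix.mulVecLin_apply, basisMatrix_mulVec]
    refine sum_mem fun l _ => Submodule.smul_mem _ _ ?_
    exact ⟨M.vec ⟨.base i, B.label i l⟩, Submodule.subset_span ⟨_, B.label_mem i l, rfl⟩,
      M.baseProj_vec _⟩
  · rw [Submodule.map_span_le]
    rintro _ ⟨u, hu, rfl⟩
    by_cases h : FramedVertex.base i = u.target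
    · obtain ⟨x, p⟩ := u
      subst h
      obtain ⟨l, rfl⟩ := (B.mem_iff i p).1 hu
      refine ⟨Pi.single l 1, ?_⟩
      rw [Matrix.mulVecLin_apply, Matrix.mulVec_single_one, M.baseProj_vec]
      rfl
    · rw [baseProj_vec_of_ne M h]
      exact zero_mem _

/-- The tree `S` indexes a basis iff the determinants of all basis matrices are nonzero. -/
theorem isTreeBasis_iff [Finite I] (hS : S ∈ treesOfDim d) (M : FramedRep w d) :
    M.IsTreeBasis S ↔ ∀ i, (B.basisMatrix M i).det ≠ 0 := by
  classical
  rw [isTreeBasis_iff_span M hS]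
  have hdet : ∀ i, (B.basisMatrix M i).det ≠ 0 ↔
      LinearMap.range (B.basisMatrix M i).mulVecLin = ⊤ := fun i => by
    rw [LinearMap.range_eq_top, ← isUnit_iff_ne_zero, ← Matrix.isUnit_iff_isUnit_det,
      ← Matrix.mulVec_surjective_iff_isUnit]
    rfl
  simp only [hdet]
  constructor
  · intro h i
    rw [range_basisMatrix, h, Submodule.map_top, LinearMap.range_eq_top]
    exact LinearMap.proj_surjective (φ := Space w d) (.base i)
  · intro h
    have := Fintype.ofFinite (FramedVertex w)
    refine eq_top_iff.2 fun m _ => ?_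
    rw [← Finset.univ_sum_single m]
    refine sum_mem fun x _ => ?_
    cases x with
    -- No determinant is needed at `∞`, where the vector of the root already spans.
    | infty =>
      rw [M.pathVector_nil_smul (m .infty), Pi.single_smul]
      refine Submodule.smul_mem _ _ (Submodule.subset_span ⟨root w, hS.1.root_mem, ?_⟩)
      rw [vec_def]
      congr
    | base i =>
      have hmem : baseProj w d i m ∈ LinearMap.range (B.basisMatrix M i).mulVecLin :=
        h i ▸ Submodule.mem_top
      obtain ⟨c, hc⟩ := hmem
      have hs : Pi.single (.base i) (m (.base i)) = baseIncl w d i (baseProj w d i m) :=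
        rfl
      rw [hs, ← hc, Matrix.mulVecLin_apply, basisMatrix_mulVec, map_sum]
      refine sum_mem fun l _ => ?_
      rw [map_smul, baseIncl_baseVector]
      exact Submodule.smul_mem _ _ (Submodule.subset_span ⟨_, B.label_mem i l, rfl⟩)

/-! ### Normal forms -/

/-- The representation obtained from `M` by passing to the bases indexed by `S`. -/
noncomputable def normalForm (M : FramedRep w d) : FramedRep w d
  | .arrow (i := i) (j := j) a k l =>
      ((B.basisMatrix M j)⁻¹ * M.arrowMatrix a * B.basisMatrix M i) k l
  | .frame i k l => ((B.basisMatrix M i)⁻¹ * M.frameMatrix i) k l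

/-- Only the factors `g i` have to cancel, so the basis matrices need not be invertible. The entries
of the normal form thus descend to the whole quotient, not merely to the chart. -/
theorem normalForm_gauge (g : GaugeGroup d) (M : FramedRep w d) :
    B.normalForm (g • M) = B.normalForm M := by
  have hg : ∀ i, (g i)⁻¹.val * (g i).val = 1 := fun i => by
    rw [← Units.val_mul, inv_mul_cancel, Units.val_one]
  refine ext_matrix (fun i j a => ?_) (fun i => ?_)
  · change (B.basisMatrix (g • M) j)⁻¹ * ((g j).val * M.arrowMatrix a * ((g i)⁻¹).val) *
      B.basisMatrix (g • M) i = (B.basisMatrix M j)⁻¹ * M.arrowMatrix a * B.basisMatrix M i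
    rw [basisMatrix_gauge, basisMatrix_gauge, Matrix.mul_inv_rev, ← Matrix.coe_units_inv]
    calc _ = (B.basisMatrix M j)⁻¹ * ((g j)⁻¹.val * (g j).val) * M.arrowMatrix a *
          ((g i)⁻¹.val * (g i).val) * B.basisMatrix M i := by simp only [Matrix.mul_assoc]
      _ = _ := by rw [hg, hg, Matrix.mul_one, Matrix.mul_one]
  · change (B.basisMatrix (g • M) i)⁻¹ * ((g i).val * M.frameMatrix i) =
      (B.basisMatrix M i)⁻¹ * M.frameMatrix i
    rw [basisMatrix_gauge, Matrix.mul_inv_rev, ← Matrix.coe_units_inv]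
    calc _ = (B.basisMatrix M i)⁻¹ * ((g i)⁻¹.val * (g i).val) * M.frameMatrix i := by
          simp only [Matrix.mul_assoc]
      _ = _ := by rw [hg, Matrix.mul_one]

/-- The change of bases that brings `M` to its normal form. -/
noncomputable def normalizer {M : FramedRep w d} (hM : ∀ i, (B.basisMatrix M i).det ≠ 0) :
    GaugeGroup d :=
  fun i => (Matrix.GeneralLinearGroup.mkOfDetNeZero (B.basisMatrix M i) (hM i))⁻¹

theorem val_normalizer {M : FramedRep w d} (hM : ∀ i, (B.basisMatrix M i).det ≠ 0) (i : I) :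
    (B.normalizer hM i).val = (B.basisMatrix M i)⁻¹ := by
  rw [normalizer, Matrix.coe_units_inv]
  rfl

theorem normalizer_smul {M : FramedRep w d} (hM : ∀ i, (B.basisMatrix M i).det ≠ 0) :
    B.normalizer hM • M = B.normalForm M := by
  have hinv : ∀ i, ((B.normalizer hM i)⁻¹).val = B.basisMatrix M i := fun i => by
    rw [normalizer, inv_inv]
    rfl
  refine ext_matrix (fun i j a => ?_) fun i => ?_
  · change (B.normalizer hM j).val * M.arrowMatrix a * ((B.normalizer hM i)⁻¹).val = _
    rw [hinv, val_normalizer]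
    rfl
  · change (B.normalizer hM i).val * M.frameMatrix i = _
    rw [val_normalizer]
    rfl

theorem basisMatrix_normalForm {M : FramedRep w d} (hM : ∀ i, (B.basisMatrix M i).det ≠ 0) (i : I) :
    B.basisMatrix (B.normalForm M) i = 1 := by
  rw [← B.normalizer_smul hM, basisMatrix_gauge, val_normalizer,
    Matrix.nonsing_inv_mul _ (isUnit_iff_ne_zero.2 (hM i))]

theorem normalForm_eq_self {M : FramedRep w d} (hM : ∀ i, B.basisMatrix M i = 1) :
    B.normalForm M = M := by
  refine ext_matrix (fun i j a => ?_) fun i => ?_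
  · change (B.basisMatrix M j)⁻¹ * M.arrowMatrix a * B.basisMatrix M i = _
    rw [hM, hM, inv_one, Matrix.one_mul, Matrix.mul_one]
  · change (B.basisMatrix M i)⁻¹ * M.frameMatrix i = _
    rw [hM, inv_one, Matrix.one_mul]

end Labelling

end RootedPath

/-! ## The cells -/

namespace FramedRepCoord

variable {I : Type u} [Quiver.{v} I] {w d : I → ℕ}

instance instFinite [Finite I] [∀ i j : I, Finite (i ⟶ j)] : Finite (FramedRepCoord w d) :=
  Finite.of_surjective
    (Sum.elim
      (fun z : Σ (i : I) (j : I), (i ⟶ j) × Fin (d j) × Fin (d i) =>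
        FramedRepCoord.arrow z.2.2.1 z.2.2.2.1 z.2.2.2.2)
      fun z : Σ i : I, Fin (d i) × Fin (w i) => FramedRepCoord.frame z.1 z.2.1 z.2.2)
    fun c => match c with
      | .arrow a k l => ⟨.inl ⟨_, _, a, k, l⟩, rfl⟩
      | .frame i k l => ⟨.inr ⟨i, k, l⟩, rfl⟩

/-- The vertex at which the arrow of a matrix entry ends. -/
def target : FramedRepCoord w d → I
  | .arrow (j := j) _ _ _ => j
  | .frame i _ _ => i

/-- The row of a matrix entry. -/
def row : (c : FramedRepCoord w d) → Fin (d c.target)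
  | .arrow _ k _ => k
  | .frame _ k _ => k

end FramedRepCoord

namespace RootedPath.Labelling

open FramedRep

variable {I : Type u} [Quiver.{v} I] {w d : I → ℕ} {S : Finset (RootedPath w)} (B : Labelling S d)

/-- The path whose vector, for a representation in normal form, is the column of a matrix entry. -/
def column : (c : FramedRepCoord w d) →
    Quiver.Path (FramedVertex.infty : FramedVertex w) (.base c.target)
  | .arrow (i := i) a _ l => (B.label i l).cons (FramedArrow.arrow a)
  | .frame i _ l => Quiver.Path.nil.cons (FramedArrow.frame i l)

/-! ### Normalized representations -/

/-- A representation is normalized if the vectors indexed by `S` are the standard bases. -/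
def IsNormalized (M : FramedRep w d) : Prop :=
  ∀ i, B.basisMatrix M i = 1

variable {B} in
theorem IsNormalized.baseVector_label {M : FramedRep w d} (hM : B.IsNormalized M) (i : I)
    (l : Fin (d i)) : M.baseVector (B.label i l) = Pi.single l 1 := by
  funext k
  have h : B.basisMatrix M i k l = M.baseVector (B.label i l) k := rfl
  rw [← h, hM, Matrix.one_apply, Pi.single_apply]

variable {B} in
theorem IsNormalized.baseVector_column {M : FramedRep w d} (hM : B.IsNormalized M)
    (c : FramedRepCoord w d) : M.baseVector (B.column c) c.row = M c := by
  cases c with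
  | @arrow i j a k l =>
    change M.baseVector ((B.label i l).cons (FramedArrow.arrow a)) k = _
    rw [baseVector_cons_arrow, hM.baseVector_label, Matrix.mulVec_single_one]
    rfl
  | frame i k l =>
    change M.baseVector (Quiver.Path.nil.cons (FramedArrow.frame i l)) k = _
    rw [baseVector_cons_frame]
    rfl

theorem column_mem_or (hS : IsSubtree S) (c : FramedRepCoord w d) :
    RootedPath.mk (.base c.target) (B.column c) ∈ S ∨
      RootedPath.mk (.base c.target) (B.column c) ∈ criticalSet S := by
  cases c with
  | @arrow i j a k l => exact hS.snoc_mem (B.label_mem i l) (FramedArrow.arrow a)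
  | frame i k l => exact hS.snoc_mem hS.root_mem (FramedArrow.frame i l)

/-! ### Regularity of the normal form -/

open SpaceWithFunctions in
theorem det_basisMatrix_mem_polynomialFunctions (i : I) :
    (fun M : FramedRepCoord w d → ℂ => (B.basisMatrix M i).det) ∈
      polynomialFunctions (FramedRepCoord w d) :=
  det_mem_polynomialFunctions fun k l =>
    baseVector_mem_polynomialFunctions _ (B.label i l) k le_rfl

-- Cramer's rule: only the basis matrix at the target vertex is inverted. Where its determinant
-- vanishes, both sides are 0 by convention.
open SpaceWithFunctions in
theorem exists_normalForm_eq_div (c : FramedRepCoord w d) :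
    ∃ p ∈ polynomialFunctions (FramedRepCoord w d), ∀ M : FramedRep w d,
      B.normalForm M c = p M / (B.basisMatrix M c.target).det := by
  have hB : ∀ i k l, (fun M : FramedRepCoord w d → ℂ => B.basisMatrix M i k l) ∈
      polynomialFunctions (FramedRepCoord w d) := fun i k l =>
    baseVector_mem_polynomialFunctions _ (B.label i l) k le_rfl
  have hinv : ∀ {n : ℕ} (A : Matrix (Fin n) (Fin n) ℂ), A⁻¹ = A.det⁻¹ • A.adjugate := fun A => by
    rw [Matrix.inv_def, Ring.inverse_eq_inv']
  cases c with
  | @arrow i j a k l =>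
    refine ⟨fun M => ((B.basisMatrix M j).adjugate * arrowMatrix M a * B.basisMatrix M i) k l,
      ?_, fun M => ?_⟩
    · refine mul_apply_mem_polynomialFunctions (mul_apply_mem_polynomialFunctions
        (adjugate_mem_polynomialFunctions (hB j)) fun k l => ?_) (hB i) k l
      exact coord_mem_polynomialFunctions (FramedRepCoord.arrow a k l)
    · change ((B.basisMatrix M j)⁻¹ * M.arrowMatrix a * B.basisMatrix M i) k l = _
      rw [hinv, Matrix.smul_mul, Matrix.smul_mul, Matrix.smul_apply, smul_eq_mul, div_eq_inv_mul]
      rfl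
  | frame i k l =>
    refine ⟨fun M => ((B.basisMatrix M i).adjugate * frameMatrix M i) k l, ?_, fun M => ?_⟩
    · refine mul_apply_mem_polynomialFunctions
        (adjugate_mem_polynomialFunctions (hB i)) (fun k l => ?_) k l
      exact coord_mem_polynomialFunctions (FramedRepCoord.frame i k l)
    · change ((B.basisMatrix M i)⁻¹ * M.frameMatrix i) k l = _
      rw [hinv, Matrix.smul_mul, Matrix.smul_apply, smul_eq_mul, div_eq_inv_mul]
      rfl

/-! ### Free matrix entries -/

variable [LinearOrder (RootedPath w)]

/-- The matrix entries that are free parameters on the cell of `S`. -/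
def IsFree (c : FramedRepCoord w d) : Prop :=
  RootedPath.mk (.base c.target) (B.column c) ∉ S ∧
    RootedPath.mk (.base c.target) (B.label c.target c.row) <
      RootedPath.mk (.base c.target) (B.column c)

open Classical in
/-- The normalized representation with given values of the free matrix entries. -/
noncomputable def cellRep (x : {c // B.IsFree c} → ℂ) : FramedRep w d := fun c =>
  if h : B.IsFree c then x ⟨c, h⟩ else if B.label c.target c.row = B.column c then 1 else 0

-- The `k`-th coordinate at `j` vanishes on every m_u, u ∈ S, except the one labelled by `k`, and
-- that path is not below `q`.
variable {B} in
theorem IsNormalized.baseVector_eq_zero {M : FramedRep w d} (hM : B.IsNormalized M) {j : I}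
    {q : Quiver.Path (FramedVertex.infty : FramedVertex w) (.base j)}
    (hq : M.vec ⟨.base j, q⟩ ∈ Submodule.span ℂ (M.vec '' {u | u ∈ S ∧ u < ⟨.base j, q⟩}))
    {k : Fin (d j)} (hk : RootedPath.mk (.base j) q ≤ ⟨.base j, B.label j k⟩) :
    M.baseVector q k = 0 := by
  have hle : Submodule.span ℂ (M.vec '' {u | u ∈ S ∧ u < ⟨.base j, q⟩}) ≤
      LinearMap.ker (LinearMap.proj (R := ℂ) (φ := fun _ : Fin (d j) => ℂ) k ∘ₗ
        baseProj w d j) := by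
    rw [Submodule.span_le]
    rintro _ ⟨u, ⟨hu, huq⟩, rfl⟩
    rw [SetLike.mem_coe, LinearMap.mem_ker, LinearMap.comp_apply, LinearMap.proj_apply]
    by_cases h : FramedVertex.base j = u.target
    · obtain ⟨x, p⟩ := u
      subst h
      obtain ⟨l, rfl⟩ := (B.mem_iff j p).1 hu
      rw [baseProj_vec, hM.baseVector_label]
      refine Pi.single_eq_of_ne (fun hkl => ?_) _
      subst hkl
      exact (huq.trans_le hk).false
    · rw [baseProj_vec_of_ne M h, Pi.zero_apply]
  have := hle hq
  rwa [LinearMap.mem_ker, LinearMap.comp_apply, LinearMap.proj_apply, baseProj_vec] at this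

-- The coordinates of the vector of `q` are its coefficients over the tree basis, so only labels
-- with nonzero coordinate matter.
variable {B} in
theorem IsNormalized.vec_mem_span {M : FramedRep w d} (hM : B.IsNormalized M) {j : I}
    {q : Quiver.Path (FramedVertex.infty : FramedVertex w) (.base j)}
    (h : ∀ k, M.baseVector q k ≠ 0 →
      RootedPath.mk (.base j) (B.label j k) < ⟨.base j, q⟩) :
    M.vec ⟨.base j, q⟩ ∈ Submodule.span ℂ (M.vec '' {u | u ∈ S ∧ u < ⟨.base j, q⟩}) := by
  have hq : M.baseVector q = ∑ k, M.baseVector q k • M.baseVector (B.label j k) := by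
    rw [← basisMatrix_mulVec, hM, Matrix.one_mulVec]
  rw [← baseIncl_baseVector, hq, map_sum]
  refine sum_mem fun k _ => ?_
  rw [map_smul, baseIncl_baseVector]
  by_cases hk : M.baseVector q k = 0
  · rw [hk, zero_smul]
    exact zero_mem _
  · exact Submodule.smul_mem _ _ (Submodule.subset_span ⟨_, ⟨B.label_mem j k, h k hk⟩, rfl⟩)

variable {B} in
/-- A normalized representation in the cell is determined by its free matrix entries. -/
theorem IsNormalized.eq_cellRep (hS : IsSubtree S) {M : FramedRep w d} (hM : B.IsNormalized M)
    (hc : M.IsCellular S) : M = B.cellRep fun c => M c.1 := by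
  funext c
  rw [cellRep]
  split_ifs with hfree hcol
  · rfl
  · rw [← hM.baseVector_column, ← hcol, hM.baseVector_label, Pi.single_eq_same]
  · rw [← hM.baseVector_column]
    -- The remaining entries vanish: over a path of `S` they are the zero coordinates of a standard
    -- basis vector, and over a critical path non-freeness means that the row label does not precede
    -- the column.
    obtain hmem | hcrit := B.column_mem_or hS c
    · obtain ⟨l, hl⟩ := (B.mem_iff _ _).1 hmem
      rw [← hl, hM.baseVector_label]
      exact Pi.single_eq_of_ne (fun h => hcol ((congrArg _ h).trans hl)) _
    · refine hM.baseVector_eq_zero (hc _ hcrit) ?_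
      by_contra hlt
      exact hfree ⟨hcrit.1, not_le.1 hlt⟩

theorem cellRep_of_column_mem {c : FramedRepCoord w d}
    (hc : RootedPath.mk (.base c.target) (B.column c) ∈ S) (x : {c // B.IsFree c} → ℂ)
    {l : Fin (d c.target)} (hl : B.label c.target l = B.column c) :
    B.cellRep x c = (Pi.single l 1 : Fin (d c.target) → ℂ) c.row := by
  classical
  rw [cellRep, dif_neg fun h => h.1 hc, Pi.single_apply]
  refine if_congr ?_ rfl rfl
  rw [← hl, (B.injective _).eq_iff]

/-- A label is a framing arrow, or an arrow appended to a shorter path that is again a label because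
`S` is prefix-closed. By induction its vector is a matrix column of `cellRep`, and columns over
paths of `S` were set to standard basis vectors. -/
theorem baseVector_cellRep (hS : IsSubtree S) (x : {c // B.IsFree c} → ℂ) (n : ℕ) : ∀ (i : I)
    (l : Fin (d i)), (B.label i l).length ≤ n →
      (B.cellRep x).baseVector (B.label i l) = Pi.single l 1 := by
  induction n with
  | zero =>
    intro i l hl
    obtain ⟨m, hm⟩ | ⟨j, q, a, hm⟩ := exists_eq_cons (B.label i l) <;>
    · rw [hm] at hl
      exact absurd hl (Nat.not_succ_le_zero _)
  | succ n ih =>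
    intro i l hl
    have hmem := B.label_mem i l
    obtain ⟨m, hm⟩ | ⟨j, q, a, hm⟩ := exists_eq_cons (B.label i l)
    · rw [hm] at hmem ⊢
      rw [baseVector_cons_frame]
      funext k
      exact B.cellRep_of_column_mem (c := .frame i k m) hmem x hm
    · rw [hm] at hmem hl ⊢
      obtain ⟨l', rfl⟩ := (B.mem_iff j q).1 (hS.2 _ hmem ⟨_, q⟩ (prefix_snoc_self ⟨_, q⟩ _))
      rw [baseVector_cons_arrow, ih j l' (Nat.le_of_succ_le_succ hl), Matrix.mulVec_single_one]
      funext k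
      exact B.cellRep_of_column_mem (c := .arrow a k l') hmem x hm

theorem isNormalized_cellRep (hS : IsSubtree S) (x : {c // B.IsFree c} → ℂ) :
    B.IsNormalized (B.cellRep x) := by
  intro i
  ext k l
  change (B.cellRep x).baseVector (B.label i l) k = _
  rw [B.baseVector_cellRep hS x _ i l le_rfl, Matrix.one_apply, Pi.single_apply]

theorem lt_of_cellRep_ne_zero {c : FramedRepCoord w d}
    (hc : RootedPath.mk (.base c.target) (B.column c) ∉ S) {x : {c // B.IsFree c} → ℂ}
    (h : B.cellRep x c ≠ 0) : RootedPath.mk (.base c.target) (B.label c.target c.row) <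
      RootedPath.mk (.base c.target) (B.column c) := by
  by_contra hlt
  have hcol : B.label c.target c.row ≠ B.column c := fun h => hc (h ▸ B.label_mem _ _)
  rw [cellRep, dif_neg fun h => hlt h.2, if_neg hcol] at h
  exact h rfl

/-- A critical path is one arrow beyond the tree, so its vector is a matrix column; the nonzero
entries there are free, hence in rows whose label precedes the path. -/
theorem isCellular_cellRep (hS : IsSubtree S) (x : {c // B.IsFree c} → ℂ) :
    (B.cellRep x).IsCellular S := by
  have hN := B.isNormalized_cellRep hS x
  have key : ∀ c : FramedRepCoord w d, RootedPath.mk (.base c.target) (B.column c) ∉ S →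
      (B.cellRep x).baseVector (B.column c) c.row ≠ 0 →
      RootedPath.mk (.base c.target) (B.label c.target c.row) <
      RootedPath.mk (.base c.target) (B.column c) := fun c hc h =>
    B.lt_of_cellRep_ne_zero hc (by rwa [hN.baseVector_column] at h)
  intro v hv
  obtain ⟨u, hu, y, a, rfl⟩ := exists_snoc_of_mem_criticalSet hS hv
  obtain ⟨z, q⟩ := u
  change FramedArrow w z y at a
  cases a with
  | frame i l =>
    cases q with
    | nil => exact hN.vec_mem_span fun k => key (.frame i k l) hv.1
    | cons q b => exact (isEmpty_framedArrow_infty _).elim b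
  | @arrow i j a =>
    obtain ⟨l, rfl⟩ := (B.mem_iff i q).1 hu
    exact hN.vec_mem_span fun k => key (.arrow a k l) hv.1

end RootedPath.Labelling

namespace NCHilb

open RootedPath FramedRep SpaceWithFunctions

variable {I : Type u} [Quiver.{v} I] {w d : I → ℕ}

theorem mk_surjective : Function.Surjective (mk : StableRep w d → NCHilb w d) :=
  Quotient.mk_surjective

theorem mk_eq_mk_iff {M N : StableRep w d} : mk M = mk N ↔ ∃ g : GaugeGroup d, g • N.1 = M.1 :=
  Quotient.eq

/-- Gauge invariance lets chart and cell membership be tested on any representative. -/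
theorem mk_mem_image_iff {P : FramedRep w d → Prop}
    (hP : ∀ (g : GaugeGroup d) (M : FramedRep w d), P M → P (g • M)) {M : StableRep w d} :
    mk M ∈ mk '' {M | P M.1} ↔ P M.1 := by
  constructor
  · rintro ⟨N, hN, h⟩
    obtain ⟨g, hg⟩ := mk_eq_mk_iff.1 h.symm
    rw [← hg]
    exact hP g _ hN
  · exact fun h => ⟨M, h, rfl⟩

theorem cell_subset_openChart [LinearOrder (RootedPath w)] {S : Finset (RootedPath w)} :
    cell d S ⊆ openChart d S :=
  Set.image_mono fun _ h => h.1

theorem isMorphism_cellRep [LinearOrder (RootedPath w)] {S : Finset (RootedPath w)}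
    (B : Labelling S d) :
    IsMorphism (affineSpace {c // B.IsFree c}) (affineSpace (FramedRepCoord w d)) B.cellRep := by
  refine isMorphism_affineSpace _ fun c => ?_
  by_cases h : B.IsFree c
  · have : (fun x => B.cellRep x c) = fun x => x ⟨c, h⟩ := funext fun x => dif_pos h
    rw [this]
    exact isRegular_of_mem_polynomialFunctions (coord_mem_polynomialFunctions _) _
  · have : (fun x => B.cellRep x c) = fun _ => B.cellRep 0 c := funext fun x => by
      rw [Labelling.cellRep, Labelling.cellRep, dif_neg h, dif_neg h]
    rw [this]
    exact (affineSpace _).const _ (@isOpen_univ _ (affineSpace _).top)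

/-! ### Open charts and their coordinates -/

section charts

variable [Finite I] {S : Finset (RootedPath w)}

theorem isTreeBasis_gauge (hS : S ∈ treesOfDim d) (g : GaugeGroup d) (M : FramedRep w d)
    (h : M.IsTreeBasis S) : (g • M).IsTreeBasis S := by
  obtain ⟨B⟩ := nonempty_labelling hS
  rw [B.isTreeBasis_iff hS] at h ⊢
  intro i
  rw [B.basisMatrix_gauge, Matrix.det_mul]
  exact mul_ne_zero ((Matrix.isUnit_iff_isUnit_det _).1 (g i).isUnit).ne_zero (h i)

theorem mk_mem_openChart (hS : S ∈ treesOfDim d) {M : StableRep w d} :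
    mk M ∈ openChart d S ↔ M.1.IsTreeBasis S :=
  mk_mem_image_iff (P := fun M => M.IsTreeBasis S) (isTreeBasis_gauge hS)

theorem mk_mem_cell [LinearOrder (RootedPath w)] (hS : S ∈ treesOfDim d) {M : StableRep w d} :
    mk M ∈ cell d S ↔ M.1.IsTreeBasis S ∧ M.1.IsCellular S :=
  mk_mem_image_iff (P := fun M => M.IsTreeBasis S ∧ M.IsCellular S)
    fun g M h => ⟨isTreeBasis_gauge hS g M h.1, h.2.gauge g⟩

/-- The preimage in the stable locus is where the product of all basis determinants, a single
polynomial, does not vanish. -/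
theorem isOpen_openChart (hS : S ∈ treesOfDim d) :
    IsOpen[(variety w d).top] (openChart d S) := by
  have := Fintype.ofFinite I
  obtain ⟨B⟩ := nonempty_labelling hS
  obtain ⟨q, hq⟩ := mem_polynomialFunctions.1 (prod_mem (t := Finset.univ) fun i _ =>
    B.det_basisMatrix_mem_polynomialFunctions i)
  refine ⟨_, isOpen_eval_ne_zero q, Set.ext fun M => ?_⟩
  rw [Set.mem_preimage, Set.mem_ofPred_eq, ← hq, Finset.prod_apply, Finset.prod_ne_zero_iff]
  refine Iff.trans ?_ (mk_mem_openChart hS).symm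
  rw [B.isTreeBasis_iff hS]
  exact ⟨fun h i => h i (Finset.mem_univ i), fun h i _ => h i⟩

/-- The matrix entries of the normal form, as functions on the noncommutative Hilbert scheme. -/
noncomputable def chartCoord (B : Labelling S d) (c : FramedRepCoord w d) : NCHilb w d → ℂ :=
  Quotient.lift (fun M : StableRep w d => B.normalForm M.1 c) fun M N h => by
    obtain ⟨g, hg⟩ := mk_eq_mk_iff.1 (Quotient.sound h : mk M = mk N)
    rw [← hg, B.normalForm_gauge]

theorem chartCoord_isRegular (hS : S ∈ treesOfDim d) (B : Labelling S d)
    (c : FramedRepCoord w d) : (variety w d).IsRegular (openChart d S) (chartCoord B c) := by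
  intro M hM
  obtain ⟨p, hp, hpM⟩ := B.exists_normalForm_eq_div c
  obtain ⟨p, rfl⟩ : ∃ p' : MvPolynomial (FramedRepCoord w d) ℂ,
      p = fun x => MvPolynomial.eval x p' := by
    obtain ⟨p', hp'⟩ := mem_polynomialFunctions.1 hp
    exact ⟨p', funext hp'⟩
  obtain ⟨q, hq⟩ := mem_polynomialFunctions.1 (B.det_basisMatrix_mem_polynomialFunctions c.target)
  refine ⟨{x | MvPolynomial.eval x q ≠ 0}, isOpen_eval_ne_zero q, ?_,
    fun x => MvPolynomial.eval x p / MvPolynomial.eval x q,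
    affineSpace_isRegular_div p q fun _ h => h, fun N _ _ => ?_⟩
  · have := (B.isTreeBasis_iff hS M.1).1 ((mk_mem_openChart hS).1 hM) c.target
    exact fun h => this ((hq M.1).trans h)
  · exact (hpM N.1).trans (congrArg _ (hq N.1))

/-! ### Parametrization of the cells -/

section cells

variable [LinearOrder (RootedPath w)]

theorem cellRep_isTreeBasis (hS : S ∈ treesOfDim d) (B : Labelling S d)
    (x : {c // B.IsFree c} → ℂ) : (B.cellRep x).IsTreeBasis S := by
  rw [B.isTreeBasis_iff hS]
  intro i
  rw [B.isNormalized_cellRep hS.1 x i, Matrix.det_one]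
  exact one_ne_zero

/-- The parametrization of a cell by the free matrix entries of normalized representations. -/
noncomputable def cellParam (hS : S ∈ treesOfDim d) (B : Labelling S d)
    (x : {c // B.IsFree c} → ℂ) : NCHilb w d :=
  mk ⟨B.cellRep x, isStable_of_span_eq_top _ (cellRep_isTreeBasis hS B x).2⟩

theorem cellParam_mem (hS : S ∈ treesOfDim d) (B : Labelling S d) (x : {c // B.IsFree c} → ℂ) :
    cellParam hS B x ∈ cell d S :=
  (mk_mem_cell hS).2 ⟨cellRep_isTreeBasis hS B x, B.isCellular_cellRep hS.1 x⟩

theorem chartCoord_cellParam (hS : S ∈ treesOfDim d) (B : Labelling S d)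
    (x : {c // B.IsFree c} → ℂ) (c : {c // B.IsFree c}) :
    chartCoord B c.1 (cellParam hS B x) = x c := by
  change B.normalForm (B.cellRep x) c.1 = x c
  rw [B.normalForm_eq_self (B.isNormalized_cellRep hS.1 x), Labelling.cellRep, dif_pos c.2]

/-- The normalizer moves a representative to its normal form, which is still cellular and so is
recovered from its free entries. -/
theorem cellParam_chartCoord (hS : S ∈ treesOfDim d) (B : Labelling S d) {z : NCHilb w d}
    (hz : z ∈ cell d S) : cellParam hS B (fun c => chartCoord B c.1 z) = z := by
  obtain ⟨M, rfl⟩ := mk_surjective z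
  obtain ⟨hb, hc⟩ := (mk_mem_cell hS).1 hz
  have hdet := (B.isTreeBasis_iff hS M.1).1 hb
  have hN : B.normalForm M.1 = B.cellRep fun c => chartCoord B c.1 (mk M) := by
    refine Labelling.IsNormalized.eq_cellRep (B := B) hS.1 (B.basisMatrix_normalForm hdet) ?_
    rw [← B.normalizer_smul hdet]
    exact hc.gauge _
  exact mk_eq_mk_iff.2 ⟨B.normalizer hdet, (B.normalizer_smul hdet).trans hN⟩

/-- The cell `Z_S` is the affine space on the free matrix entries. -/
noncomputable def cellEquiv (hS : S ∈ treesOfDim d) (B : Labelling S d) :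
    cell d S ≃ ({c // B.IsFree c} → ℂ) where
  toFun z c := chartCoord B c.1 z.1
  invFun := Set.codRestrict (cellParam hS B) _ (cellParam_mem hS B)
  left_inv z := Subtype.ext (cellParam_chartCoord hS B z.2)
  right_inv x := funext fun c => chartCoord_cellParam hS B x c

theorem isMorphism_cellEquiv (hS : S ∈ treesOfDim d) (B : Labelling S d) :
    IsMorphism ((variety w d).restrict (cell d S)) (affineSpace _) (cellEquiv hS B) :=
  isMorphism_affineSpace _ fun c => restrict_isRegular_comp_val _ (isOpen_openChart hS)
    cell_subset_openChart (chartCoord_isRegular hS B c.1)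

/-- The inverse is a polynomial map into the stable locus followed by the quotient map. -/
theorem isMorphism_cellEquiv_symm (hS : S ∈ treesOfDim d) (B : Labelling S d) :
    IsMorphism (affineSpace _) ((variety w d).restrict (cell d S)) (cellEquiv hS B).symm :=
  ((isMorphism_mk _ (stableRepSetoid w d)).comp ((isMorphism_cellRep B).codRestrict (StableRep w d)
    fun x => isStable_of_span_eq_top _ (cellRep_isTreeBasis hS B x).2)).codRestrict _
      (cellParam_mem hS B)

theorem exists_isomorphic_affineSpace [∀ i j : I, Finite (i ⟶ j)] (hS : S ∈ treesOfDim d) :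
    ∃ n : ℕ, Isomorphic ((variety w d).restrict (cell d S)) (affineSpace (Fin n)) := by
  obtain ⟨B⟩ := nonempty_labelling hS
  exact isomorphic_affineSpace_fin (cellEquiv hS B) (isMorphism_cellEquiv hS B)
    (isMorphism_cellEquiv_symm hS B)

/-! ## The cell decomposition -/

theorem isOpen_openUnion (S : Finset (RootedPath w)) :
    IsOpen[(variety w d).top] (openUnion d S) :=
  @isOpen_biUnion _ _ (variety w d).top _ _ fun _ h => isOpen_openChart h.1

/-- In a common point both trees would index bases, which the cell condition of the larger tree
forbids. -/
theorem cell_disjoint (hadm : Admissible w) :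
    (treesOfDim (w := w) d).PairwiseDisjoint (cell d) := by
  intro S hS S' hS' hne
  refine Set.disjoint_left.2 fun z hz hz' => ?_
  obtain ⟨M, rfl⟩ := mk_surjective z
  obtain ⟨hb, hc⟩ := (mk_mem_cell hS).1 hz
  obtain ⟨hb', hc'⟩ := (mk_mem_cell hS').1 hz'
  rcases lt_trichotomy (α := OrderedTree w d) ⟨S, hS⟩ ⟨S', hS'⟩ with h | h | h
  · exact hc'.not_treeLT hadm hS.1 hb.1 (OrderedTree.lt_iff.1 h)
  · exact hne (congrArg Subtype.val h)
  · exact hc.not_treeLT hadm hS'.1 hb'.1 (OrderedTree.lt_iff.1 h)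

/-- A point of `U_S` lies in some cell `Z_{S'}` with `S' ≤ S`. -/
theorem exists_mem_cell [∀ i j : I, Finite (i ⟶ j)] (hadm : Admissible w)
    (hS : S ∈ treesOfDim d) {z : NCHilb w d} (hz : z ∈ openChart d S) :
    ∃ S' ∈ treesOfDim d, TreeLE S' S ∧ z ∈ cell d S' := by
  obtain ⟨M, rfl⟩ := mk_surjective z
  have : Finite (OrderedTree w d) := (finite_treesOfDim (w := w) d).to_subtype
  have hb := (mk_mem_openChart hS).1 hz
  -- A minimal basis tree below `S` exists by finiteness, and `exists_treeLT` turns minimality into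
  -- the cell condition.
  obtain ⟨T, hTS, hT⟩ := (Set.toFinite {T : OrderedTree w d |
    M.1.IsTreeBasis T.1}).exists_le_minimal (a := ⟨S, hS⟩) hb
  refine ⟨T.1, T.2, OrderedTree.le_iff.1 hTS, (mk_mem_cell T.2).2
    ⟨hT.prop, ?_⟩⟩
  by_contra hc
  obtain ⟨T', hT', hb', hlt⟩ := IsTreeBasis.exists_treeLT hadm M.2 T.2 hT.prop hc
  exact hT.not_lt (y := ⟨T', hT'⟩) hb' (OrderedTree.lt_iff.2 hlt)

theorem openUnion_eq [∀ i j : I, Finite (i ⟶ j)] (hadm : Admissible w)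
    (hS : S ∈ treesOfDim d) : openUnion d S =
      ⋃ S' ∈ {S' | S' ∈ treesOfDim d ∧ TreeLE S' S}, cell d S' := by
  apply subset_antisymm
  · refine Set.iUnion₂_subset fun T hT z hz => ?_
    obtain ⟨T', hT', hle, hz'⟩ := exists_mem_cell hadm hT.1 hz
    refine Set.mem_biUnion (show T' ∈ {S' | S' ∈ treesOfDim d ∧ TreeLE S' S} from ⟨hT', ?_⟩) hz'
    exact OrderedTree.treeLE_trans ⟨T', hT'⟩ ⟨T, hT.1⟩ ⟨S, hS⟩ hle hT.2
  · exact Set.iUnion₂_mono fun T _ => cell_subset_openChart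

theorem iUnion_cell [∀ i j : I, Finite (i ⟶ j)] (hadm : Admissible w) :
    (⋃ S ∈ treesOfDim (w := w) d, cell d S) = Set.univ := by
  refine Set.eq_univ_of_forall fun z => ?_
  obtain ⟨M, rfl⟩ := mk_surjective z
  obtain ⟨S, hS, hb⟩ := exists_isTreeBasis_of_isStable M.2
  obtain ⟨S', hS', -, hz⟩ := exists_mem_cell hadm hS ((mk_mem_openChart hS).2 hb)
  exact Set.mem_biUnion hS' hz

end cells

end charts

end NCHilb

theorem theorem2p12 {I : Type u} [Quiver.{v} I] [Finite I] [∀ i j : I, Finite (i ⟶ j)]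
    (w d : I → ℕ) [LinearOrder (RootedPath w)] (hadm : RootedPath.Admissible w) :
    -- `V_S` is open and is the union of the `Z_{S'}`, `S' ≤ S`
    (∀ S ∈ RootedPath.treesOfDim (w := w) d,
      IsOpen[(NCHilb.variety w d).top] (NCHilb.openUnion d S) ∧
      NCHilb.openUnion d S =
        ⋃ S' ∈ {S' | S' ∈ RootedPath.treesOfDim d ∧ RootedPath.TreeLE S' S}, NCHilb.cell d S') ∧
    -- the `Z_S` are pairwise disjoint and cover the whole space
    (RootedPath.treesOfDim (w := w) d).PairwiseDisjoint (NCHilb.cell d) ∧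
    (⋃ S ∈ RootedPath.treesOfDim (w := w) d, NCHilb.cell d S) = Set.univ ∧
    -- `P(d) = {S_1 < ⋯ < S_r}` and the `V_k = V_{S_k}` form a cell decomposition
    (∃ (r : ℕ) (e : Fin r ≃ RootedPath.treesOfDim (w := w) d) (V : Fin (r + 1) → Set (NCHilb w d)),
      (∀ i j, i < j ↔ RootedPath.TreeLT (e i).1 (e j).1) ∧
      (∀ k : Fin r, V k.succ = NCHilb.openUnion d (e k).1) ∧
      (NCHilb.variety w d).IsCellDecomposition V) := by
  have hdisj := NCHilb.cell_disjoint (d := d) hadm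
  refine ⟨fun S hS => ⟨NCHilb.isOpen_openUnion S, NCHilb.openUnion_eq hadm hS⟩, hdisj,
    NCHilb.iUnion_cell hadm, ?_⟩
  have : Finite (RootedPath.OrderedTree w d) :=
    (RootedPath.finite_treesOfDim (w := w) d).to_subtype
  have := Fintype.ofFinite (RootedPath.OrderedTree w d)
  obtain ⟨r, ⟨e⟩⟩ : ∃ r, Nonempty (Fin r ≃o RootedPath.OrderedTree w d) :=
    ⟨_, ⟨Fintype.orderIsoFinOfCardEq _ rfl⟩⟩
  -- The filtration is written as the union of the cells of index below `k`, which also covers the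
  -- empty first term; `j.castSucc < k.succ` means `j ≤ k`.
  have hsucc : ∀ k : Fin r, (⋃ j : Fin r, ⋃ _ : j.castSucc < k.succ, NCHilb.cell d (e j).1) =
      NCHilb.openUnion d (e k).1 := by
    intro k
    rw [NCHilb.openUnion_eq hadm (e k).2]
    ext z
    simp only [Set.mem_iUnion, Set.mem_ofPred_eq, exists_prop]
    constructor
    · rintro ⟨j, hj, hz⟩
      exact ⟨_, ⟨(e j).2, RootedPath.OrderedTree.le_iff.1
        (e.le_iff_le.2 (Fin.castSucc_lt_succ_iff.1 hj))⟩, hz⟩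
    · rintro ⟨T, ⟨hT, hle⟩, hz⟩
      obtain ⟨j, hj⟩ := e.surjective ⟨T, hT⟩
      obtain rfl : (e j).1 = T := congrArg Subtype.val hj
      exact ⟨j, Fin.castSucc_lt_succ_iff.2 (e.le_iff_le.1 (RootedPath.OrderedTree.le_iff.2 hle)),
        hz⟩
  refine ⟨_, e.toEquiv, fun k => ⋃ j : Fin r, ⋃ _ : j.castSucc < k, NCHilb.cell d (e j).1,
    fun i j => ?_, hsucc, ?_⟩
  · exact e.lt_iff_lt.symm.trans RootedPath.OrderedTree.lt_iff
  refine ⟨?_, ?_, ?_, ?_, ?_⟩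
  · simp
  · refine Set.eq_univ_of_forall fun z => ?_
    have hz : z ∈ ⋃ S ∈ RootedPath.treesOfDim (w := w) d, NCHilb.cell d S :=
      NCHilb.iUnion_cell hadm ▸ Set.mem_univ z
    simp only [Set.mem_iUnion, exists_prop] at hz ⊢
    obtain ⟨S, hS, hz⟩ := hz
    obtain ⟨j, hj⟩ := e.surjective ⟨S, hS⟩
    obtain rfl : (e j).1 = S := congrArg Subtype.val hj
    exact ⟨j, Fin.castSucc_lt_last _, hz⟩
  · exact fun k => Set.iUnion_mono fun j => Set.iUnion_mono' fun h =>
      ⟨h.trans Fin.castSucc_lt_succ, subset_rfl⟩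
  · intro k
    induction k using Fin.cases with
    | zero => simp
    | succ k =>
      rw [hsucc]
      exact NCHilb.isOpen_openUnion _
  · intro k
    -- These are unions of disjoint cells over `j ≤ k` and over `j < k`.
    have hdiff : ((⋃ j : Fin r, ⋃ _ : j.castSucc < k.succ, NCHilb.cell d (e j).1) \
        ⋃ j : Fin r, ⋃ _ : j.castSucc < k.castSucc, NCHilb.cell d (e j).1) =
        NCHilb.cell d (e k).1 := by
      ext z
      simp only [Set.mem_sdiff, Set.mem_iUnion, exists_prop, not_exists, not_and,
        Fin.castSucc_lt_succ_iff, Fin.castSucc_lt_castSucc_iff]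
      constructor
      · rintro ⟨⟨j, hj, hz⟩, h⟩
        obtain rfl | hj := hj.eq_or_lt
        · exact hz
        · exact absurd hz (h j hj)
      · refine fun hz => ⟨⟨k, le_rfl, hz⟩, fun j hj hz' => ?_⟩
        refine Set.disjoint_left.1 (hdisj (e j).2 (e k).2 fun h => ?_) hz' hz
        exact hj.ne (e.injective (Subtype.ext h))
    rw [hdiff]
    exact NCHilb.exists_isomorphic_affineSpace (e k).2
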